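/- Let $M$ be a finite-dimensional smooth manifold (Hausdorff, second countable, without boundary), let $f\in C^\infty(M)$ and let $\theta\in\Omega^1(M)$ be a closed $1$-form. For $\varphi\in\Omega^r(M)$ put $$d_f\varphi=f\,d\varphi-r\,df\wedge\varphi,\qquad d_{f,\theta}\varphi=d_f\varphi-f\theta\wedge\varphi .$$ Since $d\theta=0$, one has $d_{f,\theta}^2=0$. Let $H^r_{f,\theta}(M)$, $r\ge 0$, denote the cohomology groups of the complex $0\to\Omega^0(M)\xrightarrow{d_{f,\theta}}\Omega^1(M)\xrightarrow{d_{f,\theta}}\cdots$, and use the same notation for open subsets of $M$ with the restrictions of $f$ and $\theta$. **Theorem 2.1.** Let $\{U,V\}$ be an open cover of $M$. There are linear maps $\delta$ such that the sequence $$0\to H^0_{f,\theta}(M)\to\cdots\to H^{r}_{f,\theta}(M)\xrightarrow{\alpha_*}H^{r}_{f|_U,\theta|_U}(U)\oplus H^{r}_{f|_V,\theta|_V}(V)\xrightarrow{\beta_*}H^{r}_{f|_{U\cap V},\theta|_{U\cap V}}(U\cap V)\xrightarrow{\delta}H^{r+1}_{f,\theta}(M)\xrightarrow{\alpha_*}\cdots$$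 is exact, where $$\alpha_*([\varphi])=([\varphi|_U],[\varphi|_V]),\qquad \beta_*([\varphi],[\psi])=[\varphi|_{U\cap V}-\psi|_{U\cap V}],$$ and where, for every smooth partition of unity $\{\lambda_U,\lambda_V\}$ subordinate to $\{U,V\}$ and every $\sigma\in\Omega^r(U\cap V)$ that is closed for the operator $d_{f|_{U\cap V},\theta|_{U\cap V}}$, $$\delta([\sigma])=[d_f\lambda_V\wedge\sigma]=-[d_f\lambda_U\wedge\sigma].$$ Here the forms $d_f\lambda_V\wedge\sigma$ and $d_f\lambda_U\wedge\sigma$ on $U\cap V$ are extended by $0$ to the whole of $M$, and these extensions are smooth and $d_{f,\theta}$-closed. -/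

import Mathlib

open scoped Manifold ContDiff Topology Bundle

set_option linter.unusedSectionVars false

noncomputable section

namespace LichCoh

/-! ### Smooth dependence of `a ∘ A` on the alternating form `a` and the linear map `A` -/

section Multilinear

variable {E F : Type*} [NormedAddCommGroup E] [NormedSpace ℝ E]
  [NormedAddCommGroup F] [NormedSpace ℝ F]

/-- The continuous linear projection of multilinear forms onto alternating forms. -/
def altProj (E : Type*) [NormedAddCommGroup E] [NormedSpace ℝ E] (r : ℕ) :
    ContinuousMultilinearMap ℝ (fun _ : Fin r => E) ℝ →L[ℝ] E [⋀^Fin r]→L[ℝ] ℝ where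
  toFun f := (r.factorial : ℝ)⁻¹ • ContinuousMultilinearMap.alternatization f
  map_add' f g := by simp
  map_smul' c f := by
    ext v
    simp [ContinuousMultilinearMap.alternatization_apply_apply, Finset.mul_sum]
    refine Finset.sum_congr rfl fun σ _ => ?_
    rcases Int.units_eq_one_or (Equiv.Perm.sign σ) with h | h <;> simp [h] <;> ring
  cont := by
    rw [ContinuousAlternatingMap.isEmbedding_toContinuousMultilinearMap.continuous_iff]
    have : (fun f : ContinuousMultilinearMap ℝ (fun _ : Fin r => E) ℝ =>
        ((r.factorial : ℝ)⁻¹ • ContinuousMultilinearMap.alternatization f).toContinuousMultilinearMap)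
        = fun f => (r.factorial : ℝ)⁻¹ • ∑ σ : Equiv.Perm (Fin r),
          Equiv.Perm.sign σ • (ContinuousMultilinearMap.domDomCongrₗᵢ ℝ E ℝ σ f) := by
      funext f
      ext v
      simp only [ContinuousAlternatingMap.coe_toContinuousMultilinearMap,
        ContinuousAlternatingMap.smul_apply, _root_.smul_apply,
        _root_.sum_apply,
        ContinuousMultilinearMap.alternatization_apply_apply]
      rfl
    change Continuous (fun f : ContinuousMultilinearMap ℝ (fun _ : Fin r => E) ℝ =>
        ((r.factorial : ℝ)⁻¹ • ContinuousMultilinearMap.alternatization f).toContinuousMultilinearMap)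
    rw [this]
    fun_prop

theorem altProj_apply {r : ℕ} (a : E [⋀^Fin r]→L[ℝ] ℝ) :
    altProj E r a.toContinuousMultilinearMap = a := by
  ext v
  have h0 : (r.factorial : ℝ) ≠ 0 := by exact_mod_cast r.factorial_ne_zero
  have h : ∀ σ : Equiv.Perm (Fin r), Equiv.Perm.sign σ • a (v ∘ σ) = a v := by
    intro σ
    have := a.toAlternatingMap.map_perm v σ
    simp only [ContinuousAlternatingMap.coe_toAlternatingMap] at this
    rw [this, smul_smul]
    simp
  change (r.factorial : ℝ)⁻¹ • ContinuousMultilinearMap.alternatization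
    a.toContinuousMultilinearMap v = a v
  rw [ContinuousMultilinearMap.alternatization_apply_apply]
  change (r.factorial : ℝ)⁻¹ • (∑ σ : Equiv.Perm (Fin r), Equiv.Perm.sign σ • a (v ∘ σ)) = a v
  simp only [h]
  simp [Fintype.card_perm, h0]

theorem contDiff_compContinuousLinearMap {r : ℕ} :
    ContDiff ℝ ∞ (fun p : (F [⋀^Fin r]→L[ℝ] ℝ) × (E →L[ℝ] F) => p.1.compContinuousLinearMap p.2) := by
  have h : (fun p : (F [⋀^Fin r]→L[ℝ] ℝ) × (E →L[ℝ] F) => p.1.compContinuousLinearMap p.2)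
      = fun p => altProj E r (ContinuousMultilinearMap.compContinuousLinearMapContinuousMultilinear
          ℝ (fun _ : Fin r => E) (fun _ : Fin r => F) ℝ (fun _ => p.2)
          (ContinuousAlternatingMap.toContinuousMultilinearMapCLM ℝ p.1)) := by
    funext p
    rw [← altProj_apply (p.1.compContinuousLinearMap p.2)]
    rfl
  rw [h]
  refine (altProj E r).contDiff.comp (ContDiff.clm_apply ?_ ?_)
  · exact (ContinuousMultilinearMap.contDiff _).comp (contDiff_pi.2 fun _ => contDiff_snd)
  · exact (ContinuousLinearMap.contDiff _).comp contDiff_fst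

end Multilinear

/-! ### Differential forms, pullback and exterior derivative -/

section Forms

variable {E : Type*} [NormedAddCommGroup E] [NormedSpace ℝ E]

/-- The fibre `Λʳ T*ₓM` of the bundle of alternating `r`-linear forms on the tangent spaces. -/
abbrev AltFiber (E : Type*) [NormedAddCommGroup E] [NormedSpace ℝ E]
    (M : Type*) [TopologicalSpace M] [ChartedSpace E M] (r : ℕ) (x : M) : Type _ :=
  (TangentSpace 𝓘(ℝ, E) x) [⋀^Fin r]→L[ℝ] (Bundle.Trivial M ℝ x)

/-- `Ωʳ(M)`: the smooth differential `r`-forms on the manifold `M`, as smooth sections of Mathlib's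
bundle of continuous alternating maps on the tangent bundle. -/
abbrev DiffForm (E : Type*) [NormedAddCommGroup E] [NormedSpace ℝ E]
    (M : Type*) [TopologicalSpace M] [ChartedSpace E M] [IsManifold 𝓘(ℝ, E) ∞ M] (r : ℕ) :=
  ContMDiffSection 𝓘(ℝ, E) (E [⋀^Fin r]→L[ℝ] ℝ) ∞ (AltFiber E M r)

variable {M : Type*} [TopologicalSpace M] [ChartedSpace E M]
  {N : Type*} [TopologicalSpace N] [ChartedSpace E N] {r : ℕ}

/-- Pullback `(g^* s)ₓ = s_{g x} ∘ (dgₓ × ⋯ × dgₓ)`. -/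
def pullbackFun (g : N → M) (s : ∀ x : M, AltFiber E M r x) : ∀ x : N, AltFiber E N r x :=
  fun x => ContinuousAlternatingMap.compContinuousLinearMap (s (g x))
    (mfderiv 𝓘(ℝ, E) 𝓘(ℝ, E) g x)

/-- The form `s` in the chart at `x₀`, i.e. its pullback by the inverse of the chart, as a form on
the model vector space (meaningful on the target of the chart). -/
def rep (x₀ : M) (s : ∀ x : M, AltFiber E M r x) : E → E [⋀^Fin r]→L[ℝ] ℝ :=
  pullbackFun (extChartAt 𝓘(ℝ, E) x₀).symm s

/-- The exterior derivative: at `x`, write the form in the chart at `x`, apply the exterior derivative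
of the model vector space, and pull back by the chart. The value is the same in every chart around
`x`, see `rep_extDFun`. -/
def extDFun (s : ∀ x : M, AltFiber E M r x) : ∀ x : M, AltFiber E M (r + 1) x :=
  fun x => ContinuousAlternatingMap.compContinuousLinearMap
    (extDeriv (rep x s) (extChartAt 𝓘(ℝ, E) x x))
    (mfderiv 𝓘(ℝ, E) 𝓘(ℝ, E) (extChartAt 𝓘(ℝ, E) x) x)

theorem target_nhds {x₀ : M} {y : E} (hy : y ∈ (extChartAt 𝓘(ℝ, E) x₀).target) :
    (extChartAt 𝓘(ℝ, E) x₀).target ∈ 𝓝 y :=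
  (isOpen_extChartAt_target x₀).mem_nhds hy

theorem source_nhds {x₀ x : M} (hx : x ∈ (extChartAt 𝓘(ℝ, E) x₀).source) :
    (extChartAt 𝓘(ℝ, E) x₀).source ∈ 𝓝 x :=
  (isOpen_extChartAt_source x₀).mem_nhds hx

theorem pullbackFun_id (s : ∀ x : M, AltFiber E M r x) : pullbackFun (fun x : M => x) s = s := by
  funext x
  unfold pullbackFun
  have : mfderiv 𝓘(ℝ, E) 𝓘(ℝ, E) (fun x : M => x) x = ContinuousLinearMap.id ℝ _ := mfderiv_id
  rw [this]
  ext v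
  simp

variable [IsManifold 𝓘(ℝ, E) ∞ M] [IsManifold 𝓘(ℝ, E) ∞ N]

theorem mdiff_chart {x₀ x : M} (hx : x ∈ (chartAt E x₀).source) :
    MDifferentiableAt 𝓘(ℝ, E) 𝓘(ℝ, E) (extChartAt 𝓘(ℝ, E) x₀) x :=
  mdifferentiableAt_extChartAt hx

theorem mdiff_symm {x₀ : M} {y : E} (hy : y ∈ (extChartAt 𝓘(ℝ, E) x₀).target) :
    MDifferentiableAt 𝓘(ℝ, E) 𝓘(ℝ, E) (extChartAt 𝓘(ℝ, E) x₀).symm y := by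
  have := mdifferentiableWithinAt_extChartAt_symm (I := 𝓘(ℝ, E)) hy
  rwa [show Set.range 𝓘(ℝ, E) = Set.univ by simp, mdifferentiableWithinAt_univ] at this

/-- Smoothness of a form at a point, read in the chart at that point. -/
theorem contMDiffAt_form_iff (s : ∀ x : M, AltFiber E M r x) (x₀ : M) :
    ContMDiffAt 𝓘(ℝ, E) (𝓘(ℝ, E).prod 𝓘(ℝ, E [⋀^Fin r]→L[ℝ] ℝ)) ∞
      (fun x => Bundle.TotalSpace.mk' (E [⋀^Fin r]→L[ℝ] ℝ) x (s x)) x₀ ↔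
    ContDiffAt ℝ ∞ (rep x₀ s) (extChartAt 𝓘(ℝ, E) x₀ x₀) := by
  rw [Bundle.contMDiffAt_section, contMDiffAt_iff_source]
  rw [show Set.range 𝓘(ℝ, E) = Set.univ by simp, contMDiffWithinAt_univ, contMDiffAt_iff_contDiffAt]
  suffices main : (fun x => (trivializationAt (E [⋀^Fin r]→L[ℝ] ℝ) (AltFiber E M r) x₀
      ⟨x, s x⟩).2) ∘ (extChartAt 𝓘(ℝ, E) x₀).symm =ᶠ[𝓝 (extChartAt 𝓘(ℝ, E) x₀ x₀)] rep x₀ s by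
    exact ⟨fun h => h.congr_of_eventuallyEq main.symm, fun h => h.congr_of_eventuallyEq main⟩
  filter_upwards [target_nhds (mem_extChartAt_target (I := 𝓘(ℝ, E)) x₀)] with y hy
  have hs : (extChartAt 𝓘(ℝ, E) x₀).symm y ∈ (chartAt E x₀).source := by
    rw [← extChartAt_source 𝓘(ℝ, E)]; exact (extChartAt 𝓘(ℝ, E) x₀).map_target hy
  have := TangentBundle.symmL_trivializationAt (𝕜 := ℝ) (I := 𝓘(ℝ, E)) hs
  rw [show Set.range 𝓘(ℝ, E) = Set.univ by simp, mfderivWithin_univ,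
    (extChartAt 𝓘(ℝ, E) x₀).right_inv hy] at this
  simp only [Function.comp_apply]
  rw [FiberBundle.trivializationAt_continuousAlternatingMap_apply]
  simp only [ContinuousAlternatingMap.inCoordinates]
  rw [this]
  ext v
  simp [rep, pullbackFun]
  rfl

/-- The expression of a pullback in charts. -/
theorem rep_pullback (g : N → M) (s : ∀ x : M, AltFiber E M r x) (y₀ : N) (x₀ : M) {z : E}
    (hz : z ∈ (extChartAt 𝓘(ℝ, E) y₀).target)
    (hg : MDifferentiableAt 𝓘(ℝ, E) 𝓘(ℝ, E) g ((extChartAt 𝓘(ℝ, E) y₀).symm z))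
    (hx : g ((extChartAt 𝓘(ℝ, E) y₀).symm z) ∈ (extChartAt 𝓘(ℝ, E) x₀).source) :
    rep y₀ (pullbackFun g s) z =
      (rep x₀ s (extChartAt 𝓘(ℝ, E) x₀ (g ((extChartAt 𝓘(ℝ, E) y₀).symm z)))).compContinuousLinearMap
        (fderiv ℝ (fun z => extChartAt 𝓘(ℝ, E) x₀ (g ((extChartAt 𝓘(ℝ, E) y₀).symm z))) z) := by
  set ψ := (extChartAt 𝓘(ℝ, E) y₀).symm with hψ
  set φ := extChartAt 𝓘(ℝ, E) x₀ with hφ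
  have h1 : MDifferentiableAt 𝓘(ℝ, E) 𝓘(ℝ, E) ψ z := mdiff_symm hz
  have hgψ : MDifferentiableAt 𝓘(ℝ, E) 𝓘(ℝ, E) (g ∘ ψ) z := hg.comp z h1
  have hφ1 : MDifferentiableAt 𝓘(ℝ, E) 𝓘(ℝ, E) φ (g (ψ z)) :=
    mdiff_chart (by rw [← extChartAt_source 𝓘(ℝ, E)]; exact hx)
  have hG : MDifferentiableAt 𝓘(ℝ, E) 𝓘(ℝ, E) (φ ∘ (g ∘ ψ)) z := hφ1.comp z hgψ
  have hy : φ (g (ψ z)) ∈ φ.target := φ.map_source hx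
  have hinv : φ.symm (φ (g (ψ z))) = g (ψ z) := φ.left_inv hx
  have hev : φ.symm ∘ (φ ∘ (g ∘ ψ)) =ᶠ[𝓝 z] g ∘ ψ := by
    filter_upwards [hgψ.continuousAt (source_nhds (x₀ := x₀) hx)] with w hw
    exact φ.left_inv hw
  have key : (mfderiv 𝓘(ℝ, E) 𝓘(ℝ, E) φ.symm (φ (g (ψ z)))).comp
      (mfderiv 𝓘(ℝ, E) 𝓘(ℝ, E) (φ ∘ (g ∘ ψ)) z) =
      (mfderiv 𝓘(ℝ, E) 𝓘(ℝ, E) g (ψ z)).comp (mfderiv 𝓘(ℝ, E) 𝓘(ℝ, E) ψ z) := by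
    have a := mfderiv_comp z (mdiff_symm hy) hG
    have b := mfderiv_comp z hg h1
    have c := hev.mfderiv_eq (I := 𝓘(ℝ, E)) (I' := 𝓘(ℝ, E))
    refine a.symm.trans (Eq.trans ?_ b)
    exact c
  rw [mfderiv_eq_fderiv] at key
  have aux : ∀ (p q : M) (_ : p = q) (A B : E →L[ℝ] E), A = B →
      ContinuousAlternatingMap.compContinuousLinearMap
        (show E [⋀^Fin r]→L[ℝ] ℝ from s p) A =
      ContinuousAlternatingMap.compContinuousLinearMap
        (show E [⋀^Fin r]→L[ℝ] ℝ from s q) B := by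
    rintro p q rfl A B rfl; rfl
  exact (aux _ _ hinv _ _ key).symm


/-- The coordinate expression of a smooth map is smooth. -/
theorem coord_contDiffAt {g : N → M} (y₀ : N) (x₀ : M) {z : E}
    (hz : z ∈ (extChartAt 𝓘(ℝ, E) y₀).target)
    (hg : ContMDiffAt 𝓘(ℝ, E) 𝓘(ℝ, E) ∞ g ((extChartAt 𝓘(ℝ, E) y₀).symm z))
    (hx : g ((extChartAt 𝓘(ℝ, E) y₀).symm z) ∈ (extChartAt 𝓘(ℝ, E) x₀).source) :
    ContDiffAt ℝ ∞
      (fun z => extChartAt 𝓘(ℝ, E) x₀ (g ((extChartAt 𝓘(ℝ, E) y₀).symm z))) z := by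
  rw [← contMDiffAt_iff_contDiffAt]
  have h1 : ContMDiffAt 𝓘(ℝ, E) 𝓘(ℝ, E) ∞ (extChartAt 𝓘(ℝ, E) y₀).symm z :=
    (contMDiffOn_extChartAt_symm y₀).contMDiffAt (target_nhds hz)
  have h2 : ContMDiffAt 𝓘(ℝ, E) 𝓘(ℝ, E) ∞ (extChartAt 𝓘(ℝ, E) x₀)
      (g ((extChartAt 𝓘(ℝ, E) y₀).symm z)) :=
    contMDiffAt_extChartAt' (by rwa [← extChartAt_source 𝓘(ℝ, E)])
  exact h2.comp z (hg.comp z h1)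

theorem eventually_coord {g : N → M} (y₀ : N) (x₀ : M) {z : E}
    (hz : z ∈ (extChartAt 𝓘(ℝ, E) y₀).target)
    (hg : ContMDiffAt 𝓘(ℝ, E) 𝓘(ℝ, E) ∞ g ((extChartAt 𝓘(ℝ, E) y₀).symm z))
    (hx : g ((extChartAt 𝓘(ℝ, E) y₀).symm z) ∈ (extChartAt 𝓘(ℝ, E) x₀).source) :
    ∀ᶠ w in 𝓝 z, w ∈ (extChartAt 𝓘(ℝ, E) y₀).target ∧
      g ((extChartAt 𝓘(ℝ, E) y₀).symm w) ∈ (extChartAt 𝓘(ℝ, E) x₀).source := by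
  refine Filter.Eventually.and (target_nhds hz) ?_
  have h1 : ContMDiffAt 𝓘(ℝ, E) 𝓘(ℝ, E) ∞ (extChartAt 𝓘(ℝ, E) y₀).symm z :=
    (contMDiffOn_extChartAt_symm y₀).contMDiffAt (target_nhds hz)
  exact (hg.comp z h1).continuousAt (source_nhds hx)

theorem rep_pullback_eventually {g : N → M} (hg : ContMDiff 𝓘(ℝ, E) 𝓘(ℝ, E) ∞ g)
    (s : ∀ x : M, AltFiber E M r x) (y₀ : N) (x₀ : M) {z : E}
    (hz : z ∈ (extChartAt 𝓘(ℝ, E) y₀).target)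
    (hx : g ((extChartAt 𝓘(ℝ, E) y₀).symm z) ∈ (extChartAt 𝓘(ℝ, E) x₀).source) :
    rep y₀ (pullbackFun g s) =ᶠ[𝓝 z] fun z =>
      (rep x₀ s (extChartAt 𝓘(ℝ, E) x₀ (g ((extChartAt 𝓘(ℝ, E) y₀).symm z)))).compContinuousLinearMap
        (fderiv ℝ (fun z => extChartAt 𝓘(ℝ, E) x₀ (g ((extChartAt 𝓘(ℝ, E) y₀).symm z))) z) := by
  filter_upwards [eventually_coord y₀ x₀ hz (hg _) hx] with w hw
  exact rep_pullback g s y₀ x₀ hw.1 ((hg _).mdifferentiableAt (by simp)) hw.2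

/-- Smoothness of a section of the bundle of alternating maps. -/
def IsSmoothForm (s : ∀ x : M, AltFiber E M r x) : Prop :=
  ContMDiff 𝓘(ℝ, E) (𝓘(ℝ, E).prod 𝓘(ℝ, E [⋀^Fin r]→L[ℝ] ℝ)) ∞
      (fun x => Bundle.TotalSpace.mk' (E [⋀^Fin r]→L[ℝ] ℝ) x (s x))

theorem rep_pullback_contDiffAt {g : N → M} (hg : ContMDiff 𝓘(ℝ, E) 𝓘(ℝ, E) ∞ g)
    {s : ∀ x : M, AltFiber E M r x} (hs : IsSmoothForm s) (y₀ : N) {z : E}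
    (hz : z ∈ (extChartAt 𝓘(ℝ, E) y₀).target) :
    ContDiffAt ℝ ∞ (rep y₀ (pullbackFun g s)) z := by
  set x₀ := g ((extChartAt 𝓘(ℝ, E) y₀).symm z) with hx₀
  have hx : g ((extChartAt 𝓘(ℝ, E) y₀).symm z) ∈ (extChartAt 𝓘(ℝ, E) x₀).source :=
    mem_extChartAt_source _
  have hG := coord_contDiffAt y₀ x₀ hz (hg _) hx
  have hr : ContDiffAt ℝ ∞ (rep x₀ s)
      (extChartAt 𝓘(ℝ, E) x₀ (g ((extChartAt 𝓘(ℝ, E) y₀).symm z))) :=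
    (contMDiffAt_form_iff s x₀).1 (hs x₀)
  refine ContDiffAt.congr_of_eventuallyEq ?_ (rep_pullback_eventually hg s y₀ x₀ hz hx)
  exact contDiff_compContinuousLinearMap.contDiffAt.comp z
    ((hr.comp z hG).prodMk (hG.fderiv_right (m := ∞) (by simp)))

theorem rep_contDiffAt {s : ∀ x : M, AltFiber E M r x} (hs : IsSmoothForm s) (x₀ : M) {z : E}
    (hz : z ∈ (extChartAt 𝓘(ℝ, E) x₀).target) : ContDiffAt ℝ ∞ (rep x₀ s) z := by
  have := rep_pullback_contDiffAt (contMDiff_id (M := M)) hs x₀ hz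
  rwa [show pullbackFun id s = s from pullbackFun_id s] at this

theorem isSmoothForm_pullback {g : N → M} (hg : ContMDiff 𝓘(ℝ, E) 𝓘(ℝ, E) ∞ g)
    {s : ∀ x : M, AltFiber E M r x} (hs : IsSmoothForm s) : IsSmoothForm (pullbackFun g s) :=
  fun y₀ => (contMDiffAt_form_iff _ y₀).2
    (rep_pullback_contDiffAt hg hs y₀ (mem_extChartAt_target y₀))

theorem extDeriv_rep_pullback {g : N → M} (hg : ContMDiff 𝓘(ℝ, E) 𝓘(ℝ, E) ∞ g)
    {s : ∀ x : M, AltFiber E M r x} (hs : IsSmoothForm s) (y₀ : N) (x₀ : M) {z : E}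
    (hz : z ∈ (extChartAt 𝓘(ℝ, E) y₀).target)
    (hx : g ((extChartAt 𝓘(ℝ, E) y₀).symm z) ∈ (extChartAt 𝓘(ℝ, E) x₀).source) :
    extDeriv (rep y₀ (pullbackFun g s)) z =
      (extDeriv (rep x₀ s)
        (extChartAt 𝓘(ℝ, E) x₀ (g ((extChartAt 𝓘(ℝ, E) y₀).symm z)))).compContinuousLinearMap
        (fderiv ℝ (fun z => extChartAt 𝓘(ℝ, E) x₀ (g ((extChartAt 𝓘(ℝ, E) y₀).symm z))) z) := by
  rw [(rep_pullback_eventually hg s y₀ x₀ hz hx).extDeriv_eq]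
  have hG := coord_contDiffAt y₀ x₀ hz (hg _) hx
  have hr := rep_contDiffAt hs x₀ ((extChartAt 𝓘(ℝ, E) x₀).map_source hx)
  exact extDeriv_pullback (hr.differentiableAt (by simp)) hG
    (by rw [minSmoothness_of_isRCLikeNormedField]; exact WithTop.coe_le_coe.2 le_top)

/-- In every chart, the exterior derivative is the one of the model vector space. -/
theorem rep_extDFun {s : ∀ x : M, AltFiber E M r x} (hs : IsSmoothForm s) (x₀ : M) {z : E}
    (hz : z ∈ (extChartAt 𝓘(ℝ, E) x₀).target) :
    rep x₀ (extDFun s) z = extDeriv (rep x₀ s) z := by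
  set p := (extChartAt 𝓘(ℝ, E) x₀).symm z with hp
  have hx : id ((extChartAt 𝓘(ℝ, E) x₀).symm z) ∈ (extChartAt 𝓘(ℝ, E) p).source :=
    mem_extChartAt_source _
  have h := extDeriv_rep_pullback (contMDiff_id (M := M)) hs x₀ p hz hx
  rw [show pullbackFun id s = s from pullbackFun_id s] at h
  rw [h]
  have hd : mfderiv 𝓘(ℝ, E) 𝓘(ℝ, E) (extChartAt 𝓘(ℝ, E) p ∘ (extChartAt 𝓘(ℝ, E) x₀).symm) z =
      (mfderiv 𝓘(ℝ, E) 𝓘(ℝ, E) (extChartAt 𝓘(ℝ, E) p) p).comp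
        (mfderiv 𝓘(ℝ, E) 𝓘(ℝ, E) (extChartAt 𝓘(ℝ, E) x₀).symm z) :=
    mfderiv_comp z (mdiff_chart (mem_chart_source E p)) (mdiff_symm hz)
  rw [mfderiv_eq_fderiv] at hd
  have aux : ∀ A B : E →L[ℝ] E, A = B →
      (extDeriv (rep p s) (extChartAt 𝓘(ℝ, E) p p)).compContinuousLinearMap A =
      (extDeriv (rep p s) (extChartAt 𝓘(ℝ, E) p p)).compContinuousLinearMap B := by
    rintro A B rfl; rfl
  exact (aux _ _ hd).symm

theorem isSmoothForm_extDFun {s : ∀ x : M, AltFiber E M r x} (hs : IsSmoothForm s) :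
    IsSmoothForm (extDFun s) := by
  intro x₀
  rw [contMDiffAt_form_iff]
  have hz := mem_extChartAt_target (I := 𝓘(ℝ, E)) x₀
  have : rep x₀ (extDFun s) =ᶠ[𝓝 (extChartAt 𝓘(ℝ, E) x₀ x₀)] extDeriv (rep x₀ s) := by
    filter_upwards [target_nhds hz] with w hw using rep_extDFun hs x₀ hw
  refine ContDiffAt.congr_of_eventuallyEq ?_ this
  exact (ContinuousAlternatingMap.alternatizeUncurryFinCLM ℝ E ℝ).contDiff.contDiffAt.comp _
    ((rep_contDiffAt hs x₀ hz).fderiv_right (m := ∞) (by simp))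

theorem extDFun_pullback {g : N → M} (hg : ContMDiff 𝓘(ℝ, E) 𝓘(ℝ, E) ∞ g)
    {s : ∀ x : M, AltFiber E M r x} (hs : IsSmoothForm s) :
    extDFun (pullbackFun g s) = pullbackFun g (extDFun s) := by
  funext y
  have hz := mem_extChartAt_target (I := 𝓘(ℝ, E)) y
  have hl : (extChartAt 𝓘(ℝ, E) y).symm (extChartAt 𝓘(ℝ, E) y y) = y := extChartAt_to_inv y
  have hx : g ((extChartAt 𝓘(ℝ, E) y).symm (extChartAt 𝓘(ℝ, E) y y)) ∈
      (extChartAt 𝓘(ℝ, E) (g y)).source := by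
    rw [hl]; exact mem_extChartAt_source _
  have h := extDeriv_rep_pullback hg hs y (g y) hz hx
  rw [hl] at h
  have hgm : MDifferentiableAt 𝓘(ℝ, E) 𝓘(ℝ, E) g y := (hg y).mdifferentiableAt (by simp)
  have hφ := mdiff_chart (mem_chart_source E (g y))
  have hc := mdiff_chart (mem_chart_source E y)
  set G : E → E := fun z => extChartAt 𝓘(ℝ, E) (g y) (g ((extChartAt 𝓘(ℝ, E) y).symm z)) with hG
  have hGd : MDifferentiableAt 𝓘(ℝ, E) 𝓘(ℝ, E) G (extChartAt 𝓘(ℝ, E) y y) :=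
    ((coord_contDiffAt y (g y) hz (hg _) hx).differentiableAt (by simp)).mdifferentiableAt
  have hev : G ∘ extChartAt 𝓘(ℝ, E) y =ᶠ[𝓝 y] extChartAt 𝓘(ℝ, E) (g y) ∘ g := by
    filter_upwards [source_nhds (mem_extChartAt_source (I := 𝓘(ℝ, E)) y)] with w hw
    simp only [hG, Function.comp_apply]
    rw [(extChartAt 𝓘(ℝ, E) y).left_inv hw]
  have key : (mfderiv 𝓘(ℝ, E) 𝓘(ℝ, E) G (extChartAt 𝓘(ℝ, E) y y)).comp
      (mfderiv 𝓘(ℝ, E) 𝓘(ℝ, E) (extChartAt 𝓘(ℝ, E) y) y) =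
      (mfderiv 𝓘(ℝ, E) 𝓘(ℝ, E) (extChartAt 𝓘(ℝ, E) (g y)) (g y)).comp
        (mfderiv 𝓘(ℝ, E) 𝓘(ℝ, E) g y) := by
    have a := mfderiv_comp y hGd hc
    have b := mfderiv_comp y hφ hgm
    have c := hev.mfderiv_eq (I := 𝓘(ℝ, E)) (I' := 𝓘(ℝ, E))
    exact a.symm.trans (Eq.trans c b)
  rw [mfderiv_eq_fderiv] at key
  have aux : ∀ A B : E →L[ℝ] E, A = B →
      (extDeriv (rep (g y) s) (extChartAt 𝓘(ℝ, E) (g y) (g y))).compContinuousLinearMap A =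
      (extDeriv (rep (g y) s) (extChartAt 𝓘(ℝ, E) (g y) (g y))).compContinuousLinearMap B := by
    rintro A B rfl; rfl
  have fin := aux _ _ key
  change ContinuousAlternatingMap.compContinuousLinearMap _ _ = _
  rw [h]
  exact fin


/-! ### Wedge product with a one-form -/

/-- On a vector space, the wedge product `a ∧ b` of an alternating `1`-form with an alternating
`r`-form, `(a ∧ b)(v₀, …, vᵣ) = ∑ i, (-1)ⁱ a(vᵢ) b(v₀, …, v̂ᵢ, …, vᵣ)`. -/
def wedge₁ (a : E [⋀^Fin 1]→L[ℝ] ℝ) (b : E [⋀^Fin r]→L[ℝ] ℝ) : E [⋀^Fin (r + 1)]→L[ℝ] ℝ :=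
  ContinuousAlternatingMap.alternatizeUncurryFin
    (((ContinuousAlternatingMap.ofSubsingletonLIE (𝕜 := ℝ) (E := E) (F := ℝ) (0 : Fin 1)).symm a).smulRight b)

theorem wedge₁_apply (a : E [⋀^Fin 1]→L[ℝ] ℝ) (b : E [⋀^Fin r]→L[ℝ] ℝ) (v : Fin (r + 1) → E) :
    wedge₁ a b v = ∑ i : Fin (r + 1), (-1 : ℝ) ^ (i : ℕ) * (a (fun _ => v i) * b (i.removeNth v)) := by
  rw [wedge₁, ContinuousAlternatingMap.alternatizeUncurryFin_apply]
  refine Finset.sum_congr rfl fun i _ => ?_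
  rw [zsmul_eq_mul]
  push_cast
  rfl

theorem wedge₁_add (a : E [⋀^Fin 1]→L[ℝ] ℝ) (b b' : E [⋀^Fin r]→L[ℝ] ℝ) :
    wedge₁ a (b + b') = wedge₁ a b + wedge₁ a b' := by
  ext v
  simp only [wedge₁_apply, ContinuousAlternatingMap.add_apply, mul_add, Finset.sum_add_distrib]

theorem wedge₁_smul (c : ℝ) (a : E [⋀^Fin 1]→L[ℝ] ℝ) (b : E [⋀^Fin r]→L[ℝ] ℝ) :
    wedge₁ a (c • b) = c • wedge₁ a b := by
  ext v
  simp only [wedge₁_apply, ContinuousAlternatingMap.smul_apply, smul_eq_mul, Finset.mul_sum]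
  refine Finset.sum_congr rfl fun i _ => ?_
  ring

theorem wedge₁_comp {F : Type*} [NormedAddCommGroup F] [NormedSpace ℝ F]
    (a : E [⋀^Fin 1]→L[ℝ] ℝ) (b : E [⋀^Fin r]→L[ℝ] ℝ) (A : F →L[ℝ] E) :
    (wedge₁ a b).compContinuousLinearMap A =
      wedge₁ (a.compContinuousLinearMap A) (b.compContinuousLinearMap A) := by
  ext v
  rw [ContinuousAlternatingMap.compContinuousLinearMap_apply, wedge₁_apply, wedge₁_apply]
  rfl

theorem contDiff_wedge₁ :
    ContDiff ℝ ∞ (fun p : (E [⋀^Fin 1]→L[ℝ] ℝ) × (E [⋀^Fin r]→L[ℝ] ℝ) => wedge₁ p.1 p.2) := by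
  have h1 : ContDiff ℝ ∞ (ContinuousAlternatingMap.alternatizeUncurryFinCLM (n := r) ℝ E ℝ) :=
    ContinuousLinearMap.contDiff _
  have h2 : ContDiff ℝ ∞ (fun p : (E [⋀^Fin 1]→L[ℝ] ℝ) × (E [⋀^Fin r]→L[ℝ] ℝ) =>
      (ContinuousAlternatingMap.ofSubsingletonLIE (𝕜 := ℝ) (E := E) (F := ℝ) (0 : Fin 1)).symm p.1) :=
    (LinearIsometryEquiv.contDiff _).comp contDiff_fst
  exact h1.comp (h2.smulRight contDiff_snd)

/-- Pointwise wedge product of a `1`-form and an `r`-form on a manifold. -/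
def wedgeFun (α : ∀ x : M, AltFiber E M 1 x) (s : ∀ x : M, AltFiber E M r x) :
    ∀ x : M, AltFiber E M (r + 1) x :=
  fun x => wedge₁ (E := E) (α x) (s x)

theorem pullbackFun_wedge (g : N → M) (α : ∀ x : M, AltFiber E M 1 x)
    (s : ∀ x : M, AltFiber E M r x) :
    pullbackFun g (wedgeFun α s) = wedgeFun (pullbackFun g α) (pullbackFun g s) := by
  funext x
  exact wedge₁_comp (E := E) (F := E) (α (g x)) (s (g x)) (mfderiv 𝓘(ℝ, E) 𝓘(ℝ, E) g x)

theorem isSmoothForm_wedge {α : ∀ x : M, AltFiber E M 1 x} {s : ∀ x : M, AltFiber E M r x}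
    (hα : IsSmoothForm α) (hs : IsSmoothForm s) : IsSmoothForm (wedgeFun α s) := by
  intro x₀
  rw [contMDiffAt_form_iff]
  have h : rep x₀ (wedgeFun α s) = fun y => wedge₁ (rep x₀ α y) (rep x₀ s y) :=
    pullbackFun_wedge _ α s
  have h1 := (contMDiffAt_form_iff α x₀).1 (hα x₀)
  have h2 := (contMDiffAt_form_iff s x₀).1 (hs x₀)
  rw [h]
  exact ContDiffAt.comp (g := fun p : (E [⋀^Fin 1]→L[ℝ] ℝ) × (E [⋀^Fin r]→L[ℝ] ℝ) => wedge₁ p.1 p.2)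
    (f := fun y => (rep x₀ α y, rep x₀ s y)) _ contDiff_wedge₁.contDiffAt (h1.prodMk h2)

/-- A function regarded as a `0`-form. -/
def zeroFormFun (f : M → ℝ) : ∀ x : M, AltFiber E M 0 x :=
  fun x => ContinuousAlternatingMap.constOfIsEmpty ℝ (TangentSpace 𝓘(ℝ, E) x) (Fin 0) (f x)

theorem isSmoothForm_zeroForm {f : M → ℝ} (hf : ContMDiff 𝓘(ℝ, E) 𝓘(ℝ, ℝ) ∞ f) :
    IsSmoothForm (zeroFormFun (E := E) f) := by
  intro x₀
  rw [contMDiffAt_form_iff]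
  have hz := mem_extChartAt_target (I := 𝓘(ℝ, E)) x₀
  have h1 : ContMDiffAt 𝓘(ℝ, E) 𝓘(ℝ, ℝ) ∞ (f ∘ (extChartAt 𝓘(ℝ, E) x₀).symm)
      (extChartAt 𝓘(ℝ, E) x₀ x₀) :=
    (hf _).comp _ ((contMDiffOn_extChartAt_symm x₀).contMDiffAt (target_nhds hz))
  rw [contMDiffAt_iff_contDiffAt] at h1
  exact (ContinuousAlternatingMap.constOfIsEmptyLIE ℝ E ℝ (Fin 0)).contDiff.contDiffAt.comp _ h1

end Forms

/-! ### Operators on smooth forms -/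

section Operators

variable {E : Type*} [NormedAddCommGroup E] [NormedSpace ℝ E]
  {M : Type*} [TopologicalSpace M] [ChartedSpace E M] [IsManifold 𝓘(ℝ, E) ∞ M]
  {N : Type*} [TopologicalSpace N] [ChartedSpace E N] [IsManifold 𝓘(ℝ, E) ∞ N]
  {P : Type*} [TopologicalSpace P] [ChartedSpace E P] [IsManifold 𝓘(ℝ, E) ∞ P]
  {r : ℕ}

namespace DiffForm

instance instAddCommGroup : AddCommGroup (DiffForm E M r) := ContMDiffSection.instAddCommGroup
instance instModule : Module ℝ (DiffForm E M r) := ContMDiffSection.instModule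

theorem extDFun_add {s t : ∀ x : M, AltFiber E M r x} (hs : IsSmoothForm s) (ht : IsSmoothForm t) :
    extDFun (s + t) = extDFun s + extDFun t := by
  funext x
  have hz := mem_extChartAt_target (I := 𝓘(ℝ, E)) x
  have h : extDeriv (rep x (s + t)) (extChartAt 𝓘(ℝ, E) x x) = _ :=
    extDeriv_add ((rep_contDiffAt hs x hz).differentiableAt (by simp))
      ((rep_contDiffAt ht x hz).differentiableAt (by simp))
  unfold extDFun
  rw [h]
  rfl

theorem extDFun_smul (c : ℝ) (s : ∀ x : M, AltFiber E M r x) :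
    extDFun (c • s) = c • extDFun s := by
  funext x
  have h : extDeriv (rep x (c • s)) (extChartAt 𝓘(ℝ, E) x x) = _ :=
    extDeriv_smul c (rep x s)
  unfold extDFun
  rw [h]
  rfl

/-- The exterior derivative `d : Ωʳ(M) → Ωʳ⁺¹(M)`. -/
def d (r : ℕ) : DiffForm E M r →ₗ[ℝ] DiffForm E M (r + 1) where
  toFun φ := ⟨extDFun φ, isSmoothForm_extDFun φ.contMDiff⟩
  map_add' φ ψ := ContMDiffSection.ext fun x => congrFun (extDFun_add φ.contMDiff ψ.contMDiff) x
  map_smul' c φ := ContMDiffSection.ext fun x => congrFun (extDFun_smul c φ) x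

/-- The wedge product `φ ↦ α ∧ φ` with a `1`-form `α`. -/
def wedge (α : DiffForm E M 1) : DiffForm E M r →ₗ[ℝ] DiffForm E M (r + 1) where
  toFun φ := ⟨wedgeFun α φ, isSmoothForm_wedge α.contMDiff φ.contMDiff⟩
  map_add' φ ψ := by
    refine ContMDiffSection.ext fun x => ?_
    exact wedge₁_add (E := E) (α x) (φ x) (ψ x)
  map_smul' c φ := by
    refine ContMDiffSection.ext fun x => ?_
    exact wedge₁_smul (E := E) c (α x) (φ x)

/-- The product `φ ↦ f φ` with a smooth function `f`. -/
def funSMul (f : C^∞⟮𝓘(ℝ, E), M; ℝ⟯) : DiffForm E M r →ₗ[ℝ] DiffForm E M r where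
  toFun φ := ⟨fun x => f x • φ x, f.contMDiff.smul_section φ.contMDiff⟩
  map_add' φ ψ := ContMDiffSection.ext fun x => smul_add (f x) (φ x) (ψ x)
  map_smul' c φ := ContMDiffSection.ext fun x => smul_comm (f x) c (φ x)

/-- A smooth function regarded as a `0`-form. -/
def ofFun (f : C^∞⟮𝓘(ℝ, E), M; ℝ⟯) : DiffForm E M 0 :=
  ⟨zeroFormFun f, isSmoothForm_zeroForm f.contMDiff⟩

/-- The pullback `g^* : Ωʳ(M) → Ωʳ(N)` by a smooth map `g : N → M`. -/
def pullback (g : C^∞⟮𝓘(ℝ, E), N; 𝓘(ℝ, E), M⟯) : DiffForm E M r →ₗ[ℝ] DiffForm E N r where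
  toFun φ := ⟨pullbackFun g φ, isSmoothForm_pullback g.contMDiff φ.contMDiff⟩
  map_add' _ _ := rfl
  map_smul' _ _ := rfl

theorem pullback_comp (g : C^∞⟮𝓘(ℝ, E), N; 𝓘(ℝ, E), M⟯) (h : C^∞⟮𝓘(ℝ, E), P; 𝓘(ℝ, E), N⟯)
    (φ : DiffForm E M r) : pullback (g.comp h) φ = pullback h (pullback g φ) := by
  refine ContMDiffSection.ext fun x => ?_
  have key : mfderiv 𝓘(ℝ, E) 𝓘(ℝ, E) (g.comp h) x =
      (mfderiv 𝓘(ℝ, E) 𝓘(ℝ, E) g (h x)).comp (mfderiv 𝓘(ℝ, E) 𝓘(ℝ, E) h x) :=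
    mfderiv_comp x ((g.contMDiff _).mdifferentiableAt (by simp))
      ((h.contMDiff _).mdifferentiableAt (by simp))
  change ContinuousAlternatingMap.compContinuousLinearMap (φ (g (h x)))
    (mfderiv 𝓘(ℝ, E) 𝓘(ℝ, E) (g.comp h) x) = _
  rw [key]
  rfl

theorem pullback_d (g : C^∞⟮𝓘(ℝ, E), N; 𝓘(ℝ, E), M⟯) (φ : DiffForm E M r) :
    pullback g (d r φ) = d r (pullback g φ) :=
  ContMDiffSection.ext fun x => (congrFun (extDFun_pullback g.contMDiff φ.contMDiff) x).symm

theorem pullback_wedge (g : C^∞⟮𝓘(ℝ, E), N; 𝓘(ℝ, E), M⟯) (α : DiffForm E M 1)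
    (φ : DiffForm E M r) : pullback g (wedge α φ) = wedge (pullback g α) (pullback g φ) :=
  ContMDiffSection.ext fun x => congrFun (pullbackFun_wedge g α φ) x

theorem pullback_funSMul (g : C^∞⟮𝓘(ℝ, E), N; 𝓘(ℝ, E), M⟯) (f : C^∞⟮𝓘(ℝ, E), M; ℝ⟯)
    (φ : DiffForm E M r) : pullback g (funSMul f φ) = funSMul (f.comp g) (pullback g φ) :=
  ContMDiffSection.ext fun _ => rfl

theorem pullback_ofFun (g : C^∞⟮𝓘(ℝ, E), N; 𝓘(ℝ, E), M⟯) (f : C^∞⟮𝓘(ℝ, E), M; ℝ⟯) :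
    pullback g (ofFun f) = ofFun (f.comp g) :=
  ContMDiffSection.ext fun _ => rfl

/-- `d_f φ = f dφ - r df ∧ φ` for an `r`-form `φ`. -/
def dFun (f : C^∞⟮𝓘(ℝ, E), M; ℝ⟯) (r : ℕ) : DiffForm E M r →ₗ[ℝ] DiffForm E M (r + 1) :=
  funSMul f ∘ₗ d r -
    (r : ℝ) • (wedge (d 0 (ofFun f)) : DiffForm E M r →ₗ[ℝ] DiffForm E M (r + 1))

/-- `d_{f,θ} φ = d_f φ - f θ ∧ φ`. -/
def dTwist (f : C^∞⟮𝓘(ℝ, E), M; ℝ⟯) (θ : DiffForm E M 1) (r : ℕ) :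
    DiffForm E M r →ₗ[ℝ] DiffForm E M (r + 1) :=
  dFun f r - wedge (funSMul f θ)

theorem pullback_dTwist (g : C^∞⟮𝓘(ℝ, E), N; 𝓘(ℝ, E), M⟯) (f : C^∞⟮𝓘(ℝ, E), M; ℝ⟯)
    (θ : DiffForm E M 1) (φ : DiffForm E M r) :
    pullback g (dTwist f θ r φ) = dTwist (f.comp g) (pullback g θ) r (pullback g φ) := by
  simp only [dTwist, dFun, LinearMap.sub_apply, LinearMap.comp_apply, LinearMap.smul_apply,
    map_sub, map_smul, pullback_funSMul, pullback_d, pullback_wedge]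
  rw [← pullback_ofFun]

end DiffForm

/-! ### Cohomology -/

/-- The space of `d_{f,θ}`-closed `r`-forms. -/
def closedForms (f : C^∞⟮𝓘(ℝ, E), M; ℝ⟯) (θ : DiffForm E M 1) (r : ℕ) :
    Submodule ℝ (DiffForm E M r) :=
  LinearMap.ker (DiffForm.dTwist f θ r)

/-- The space of `d_{f,θ}`-exact `r`-forms. -/
def exactForms (f : C^∞⟮𝓘(ℝ, E), M; ℝ⟯) (θ : DiffForm E M 1) :
    ∀ r : ℕ, Submodule ℝ (DiffForm E M r)
  | 0 => ⊥
  | r + 1 => LinearMap.range (DiffForm.dTwist f θ r)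

/-- The cohomology group `H^r_{f,θ}(M)`: closed `r`-forms modulo exact `r`-forms. -/
abbrev Cohomology (f : C^∞⟮𝓘(ℝ, E), M; ℝ⟯) (θ : DiffForm E M 1) (r : ℕ) : Type _ :=
  closedForms f θ r ⧸ (exactForms f θ r).submoduleOf (closedForms f θ r)

namespace Cohomology

/-- The class of a closed form. -/
def mk (f : C^∞⟮𝓘(ℝ, E), M; ℝ⟯) (θ : DiffForm E M 1) (r : ℕ) :
    closedForms f θ r →ₗ[ℝ] Cohomology f θ r :=
  ((exactForms f θ r).submoduleOf (closedForms f θ r)).mkQ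

end Cohomology

/-- Pullback by `g : N → M`, from `d_{f,θ}`-closed forms to `d_{f',θ'}`-closed forms, where
`f' = f ∘ g` and `θ' = g^* θ`. -/
def closedForms.pullback (g : C^∞⟮𝓘(ℝ, E), N; 𝓘(ℝ, E), M⟯)
    {f : C^∞⟮𝓘(ℝ, E), M; ℝ⟯} {θ : DiffForm E M 1} {f' : C^∞⟮𝓘(ℝ, E), N; ℝ⟯} {θ' : DiffForm E N 1}
    (hf : f' = f.comp g) (hθ : θ' = DiffForm.pullback g θ) (r : ℕ) :
    closedForms f θ r →ₗ[ℝ] closedForms f' θ' r :=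
  (DiffForm.pullback g).restrict fun φ hφ => by
    subst hf hθ
    have hφ' : DiffForm.dTwist f θ r φ = 0 := hφ
    change DiffForm.dTwist _ _ r (DiffForm.pullback g φ) = 0
    rw [← DiffForm.pullback_dTwist, hφ', map_zero]

theorem pullback_mem_exactForms (g : C^∞⟮𝓘(ℝ, E), N; 𝓘(ℝ, E), M⟯)
    (f : C^∞⟮𝓘(ℝ, E), M; ℝ⟯) (θ : DiffForm E M 1) :
    ∀ (r : ℕ) (φ : DiffForm E M r), φ ∈ exactForms f θ r →
      DiffForm.pullback g φ ∈ exactForms (f.comp g) (DiffForm.pullback g θ) r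
  | 0, φ, h => by
    have h' : φ = 0 := h
    rw [h', map_zero]
    exact Submodule.zero_mem _
  | r + 1, φ, h => by
    obtain ⟨ψ, rfl⟩ := h
    exact ⟨DiffForm.pullback g ψ, (DiffForm.pullback_dTwist g f θ ψ).symm⟩

/-- The induced map `H^r_{f,θ}(M) → H^r_{f∘g,g^*θ}(N)`, `[φ] ↦ [g^* φ]`. -/
def Cohomology.pullback (g : C^∞⟮𝓘(ℝ, E), N; 𝓘(ℝ, E), M⟯)
    {f : C^∞⟮𝓘(ℝ, E), M; ℝ⟯} {θ : DiffForm E M 1} {f' : C^∞⟮𝓘(ℝ, E), N; ℝ⟯} {θ' : DiffForm E N 1}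
    (hf : f' = f.comp g) (hθ : θ' = DiffForm.pullback g θ) (r : ℕ) :
    Cohomology f θ r →ₗ[ℝ] Cohomology f' θ' r :=
  Submodule.mapQ _ _ (closedForms.pullback g hf hθ r) fun φ hφ => by
    subst hf hθ
    exact pullback_mem_exactForms g f θ r φ hφ

end Operators

/-! ### Open subsets -/

section Open

open TopologicalSpace (Opens)

variable {E : Type*} [NormedAddCommGroup E] [NormedSpace ℝ E]
  {M : Type*} [TopologicalSpace M] [ChartedSpace E M] [IsManifold 𝓘(ℝ, E) ∞ M] {r : ℕ}

/-- The inclusion of an open subset, as a smooth map. -/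
def incl (U : Opens M) : C^∞⟮𝓘(ℝ, E), U; 𝓘(ℝ, E), M⟯ := ⟨Subtype.val, contMDiff_subtype_val⟩

/-- The inclusion of an open subset into a larger one, as a smooth map. -/
def inclLE {U V : Opens M} (h : U ≤ V) : C^∞⟮𝓘(ℝ, E), U; 𝓘(ℝ, E), V⟯ :=
  ⟨Opens.inclusion h, contMDiff_inclusion h⟩

/-- The restriction `f|_U`. -/
def resFun (U : Opens M) (f : C^∞⟮𝓘(ℝ, E), M; ℝ⟯) : C^∞⟮𝓘(ℝ, E), U; ℝ⟯ := f.comp (incl U)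

/-- The restriction `φ|_U`. -/
def resForm (U : Opens M) : DiffForm E M r →ₗ[ℝ] DiffForm E U r := DiffForm.pullback (incl U)

theorem resForm_le {U V : Opens M} (h : U ≤ V) (φ : DiffForm E M r) :
    resForm U φ = DiffForm.pullback (inclLE h) (resForm V φ) :=
  DiffForm.pullback_comp (incl V) (inclLE h) φ

/-- `α_* : H^r_{f,θ}(M) → H^r_{f|U,θ|U}(U) ⊕ H^r_{f|V,θ|V}(V)`, `[φ] ↦ ([φ|_U], [φ|_V])`. -/
def alphaStar (f : C^∞⟮𝓘(ℝ, E), M; ℝ⟯) (θ : DiffForm E M 1) (U V : Opens M) (r : ℕ) :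
    Cohomology f θ r →ₗ[ℝ]
      Cohomology (resFun U f) (resForm U θ) r × Cohomology (resFun V f) (resForm V θ) r :=
  (Cohomology.pullback (incl U) rfl rfl r).prod (Cohomology.pullback (incl V) rfl rfl r)

/-- The restriction map `H^r_{f|U,θ|U}(U) → H^r_{f|W,θ|W}(W)`, `[φ] ↦ [φ|_W]`, for open `W ⊆ U`. -/
def resCohomology (f : C^∞⟮𝓘(ℝ, E), M; ℝ⟯) (θ : DiffForm E M 1) {W U : Opens M} (h : W ≤ U)
    (r : ℕ) :
    Cohomology (resFun U f) (resForm U θ) r →ₗ[ℝ] Cohomology (resFun W f) (resForm W θ) r :=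
  Cohomology.pullback (inclLE h) rfl (resForm_le h θ) r

/-- `β_* : H^r_{f|U,θ|U}(U) ⊕ H^r_{f|V,θ|V}(V) → H^r_{f|U∩V,θ|U∩V}(U ∩ V)`,
`([φ], [ψ]) ↦ [φ|_{U∩V} - ψ|_{U∩V}]`. -/
def betaStar (f : C^∞⟮𝓘(ℝ, E), M; ℝ⟯) (θ : DiffForm E M 1) (U V : Opens M) (r : ℕ) :
    (Cohomology (resFun U f) (resForm U θ) r × Cohomology (resFun V f) (resForm V θ) r) →ₗ[ℝ]
      Cohomology (resFun (U ⊓ V) f) (resForm (U ⊓ V) θ) r :=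
  (resCohomology f θ (W := U ⊓ V) (U := U) inf_le_left r).comp (LinearMap.fst ℝ
      (Cohomology (resFun U f) (resForm U θ) r) (Cohomology (resFun V f) (resForm V θ) r)) -
    (resCohomology f θ (W := U ⊓ V) (U := V) inf_le_right r).comp (LinearMap.snd ℝ
      (Cohomology (resFun U f) (resForm U θ) r) (Cohomology (resFun V f) (resForm V θ) r))

theorem alphaStar_mk (f : C^∞⟮𝓘(ℝ, E), M; ℝ⟯) (θ : DiffForm E M 1) (U V : Opens M) (r : ℕ)
    (φ : closedForms f θ r) :
    alphaStar f θ U V r (Cohomology.mk f θ r φ) =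
      (Cohomology.mk _ _ r (closedForms.pullback (incl U) rfl rfl r φ),
        Cohomology.mk _ _ r (closedForms.pullback (incl V) rfl rfl r φ)) :=
  rfl

theorem betaStar_mk (f : C^∞⟮𝓘(ℝ, E), M; ℝ⟯) (θ : DiffForm E M 1) (U V : Opens M) (r : ℕ)
    (φ : closedForms (resFun U f) (resForm U θ) r)
    (ψ : closedForms (resFun V f) (resForm V θ) r) :
    betaStar f θ U V r (Cohomology.mk _ _ r φ, Cohomology.mk _ _ r ψ) =
      Cohomology.mk (resFun (U ⊓ V) f) (resForm (U ⊓ V) θ) r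
        (closedForms.pullback (inclLE inf_le_left) rfl (resForm_le inf_le_left θ) r φ -
          closedForms.pullback (inclLE inf_le_right) rfl (resForm_le inf_le_right θ) r ψ) :=
  rfl

/-- `η` is the extension by `0` to `M` of the form `τ` on the open subset `W`. -/
def IsExtensionByZero {W : Opens M} (τ : DiffForm E W r) (η : DiffForm E M r) : Prop :=
  resForm W η = τ ∧ ∀ x : M, x ∉ W → η x = 0

end Open
end LichCoh

end

open LichCoh

namespace LichCoh

/-! ### Exterior calculus on the model vector space -/

section VectorSpace

open ContinuousAlternatingMap

variable {E : Type*} [NormedAddCommGroup E] [NormedSpace ℝ E] {r : ℕ}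

/-! The sequence is the long exact sequence of the short exact sequence of complexes `0 → Ω(M) →
Ω(U) ⊕ Ω(V) → Ω(U ∩ V) → 0`, whose maps are restriction and difference. All maps commute with
`d_{f,θ}`, because pullbacks do. Exactness on the left and in the middle is the sheaf property of
forms (`eq_of_resForm_eq`, `exists_resForm_eq`). Surjectivity on the right (`differenceSurjective`)
comes from a partition of unity: `λ_V σ` extends by zero to `U`, `λ_U σ` extends by zero to `V`, and
`σ = λ_V σ - (-λ_U σ)`.

The connecting map is handled through the relation `IsConnecting`: write `σ = a - b` on the overlap
and glue `d_{f,θ} a` and `d_{f,θ} b` to a global form `η`. The relation is linear, and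
`IsConnecting.mem_exactForms` shows that exact `σ` yields exact `η`; hence `[σ] ↦ [η]` is a
well-defined linear map (`exists_connectingHom`), and exactness at the three spots is a diagram
chase.

Two facts about the operator enter. It squares to zero (`DiffForm.dTwist_dTwist`), where the weight
`r` in `d_f` is what makes the terms cancel. It obeys `d_{f,θ}(gφ) = d_f g ∧ φ + g d_{f,θ} φ`
(`DiffForm.dTwist_funSMul`). With `a = λ_V σ` and `σ` closed, the latter gives `η = d_f λ_V ∧ σ` on
the overlap, which is the explicit formula for `δ` (`exists_isConnecting_extension`); the version
with `λ_U` follows from `λ_U + λ_V = 1`. Both facts reduce to Leibniz rules for `d`, proved on the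
model space and carried over by charts. -/

theorem alternatizeUncurryFin_comp_eq_neg {f g : E →L[ℝ] E →L[ℝ] E [⋀^Fin r]→L[ℝ] ℝ}
    (h : ∀ v w, f v w + g v w = f w v + g w v) :
    alternatizeUncurryFin (alternatizeUncurryFinCLM ℝ E ℝ ∘L f) =
      -alternatizeUncurryFin (alternatizeUncurryFinCLM ℝ E ℝ ∘L g) := by
  -- Only the antisymmetrization of a bilinear map in `v, w` survives the double alternatization,
  -- and `h` says that this part vanishes for `f + g`.
  have h' : ∀ v w u, f v w u - f w v u = -(g v w u - g w v u) := by
    intro v w u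
    have := congrArg (fun c : E [⋀^Fin r]→L[ℝ] ℝ => c u) (h v w)
    simp only [ContinuousAlternatingMap.add_apply] at this
    linarith
  ext v
  rw [ContinuousAlternatingMap.neg_apply,
    alternatizeUncurryFin_alternatizeUncurryFinCLM_comp_apply,
    alternatizeUncurryFin_alternatizeUncurryFinCLM_comp_apply]
  simp only [h', smul_neg, Finset.sum_neg_distrib]

theorem alternatizeUncurryFinCLM_comp_smulRight (a : E →L[ℝ] ℝ)
    (f : E →L[ℝ] E [⋀^Fin r]→L[ℝ] ℝ) :
    alternatizeUncurryFinCLM ℝ E ℝ ∘L a.smulRight f = a.smulRight (alternatizeUncurryFin f) := by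
  ext1 v
  exact alternatizeUncurryFin_smul (a v) f

/-- Both sides are double alternatizations, of `a(v) b(w) c` and `b(v) a(w) c`, and the sum of these
is symmetric in `v, w`. This avoids signed sums over pairs of omitted indices. -/
theorem wedge₁_anticomm (a b : E [⋀^Fin 1]→L[ℝ] ℝ) (c : E [⋀^Fin r]→L[ℝ] ℝ) :
    wedge₁ a (wedge₁ b c) = -wedge₁ b (wedge₁ a c) := by
  simp only [wedge₁]
  rw [← alternatizeUncurryFinCLM_comp_smulRight, ← alternatizeUncurryFinCLM_comp_smulRight]
  refine alternatizeUncurryFin_comp_eq_neg fun v w => ?_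
  set a' := (ofSubsingletonLIE (𝕜 := ℝ) (E := E) (F := ℝ) (0 : Fin 1)).symm a
  set b' := (ofSubsingletonLIE (𝕜 := ℝ) (E := E) (F := ℝ) (0 : Fin 1)).symm b
  change a' v • b' w • c + b' v • a' w • c = a' w • b' v • c + b' w • a' v • c
  rw [smul_comm (b' v), smul_comm (a' v), add_comm]

theorem extDeriv_funSMul {g : E → ℝ} {φ : E → E [⋀^Fin r]→L[ℝ] ℝ} {x : E}
    (hg : DifferentiableAt ℝ g x) (hφ : DifferentiableAt ℝ φ x) :
    extDeriv (fun y => g y • φ y) x =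
      wedge₁ (extDeriv (fun y => constOfIsEmpty ℝ E (Fin 0) (g y)) x) (φ x) +
        g x • extDeriv φ x := by
  rw [extDeriv_constOfIsEmpty, wedge₁, extDeriv, extDeriv, fderiv_fun_smul hg hφ,
    alternatizeUncurryFin_add, alternatizeUncurryFin_smul]
  exact add_comm _ _

/-- On a pair `(v, w)` the exterior derivative of a `1`-form is the difference of the two sides. -/
theorem fderiv_apply_comm_of_extDeriv_eq_zero {a : E → E [⋀^Fin 1]→L[ℝ] ℝ} {x : E}
    (h : extDeriv a x = 0) (v w : E) :
    fderiv ℝ a x v (fun _ => w) = fderiv ℝ a x w (fun _ => v) := by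
  have h1 : extDeriv a x ![v, w] = 0 := by rw [h]; rfl
  rw [extDeriv, alternatizeUncurryFin_apply, Fin.sum_univ_two] at h1
  have h2 : (0 : Fin 2).removeNth ![v, w] = fun _ => w := by
    funext i; fin_cases i; rfl
  have h3 : (1 : Fin 2).removeNth ![v, w] = fun _ => v := by
    funext i; fin_cases i; rfl
  rw [h2, h3] at h1
  simp at h1
  linarith

theorem exists_hasFDerivAt_smulRight {F : Type*} [NormedAddCommGroup F] [NormedSpace ℝ F]
    {a : E → E →L[ℝ] ℝ} {b : E → F} {x : E}
    (ha : DifferentiableAt ℝ a x) (hb : DifferentiableAt ℝ b x) :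
    ∃ D : E →L[ℝ] E →L[ℝ] F, HasFDerivAt (fun y => (a y).smulRight (b y)) D x ∧
      ∀ v w, D v w = a x w • fderiv ℝ b x v + fderiv ℝ a x v w • b x :=
  ⟨_, (ContinuousLinearMap.smulRightL ℝ E F).hasFDerivAt_of_bilinear ha.hasFDerivAt hb.hasFDerivAt,
    fun _ _ => rfl⟩

/-- The product rule makes the left side the double alternatization of `a(w) ∂_v b + (∂_v a)(w) b`,
while `a ∧ db` is that of `a(v) ∂_w b`. The sum is symmetric in `v, w`, because closedness of `a` at
`x` makes `(∂_v a)(w)` symmetric. -/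
theorem extDeriv_wedge₁ {a : E → E [⋀^Fin 1]→L[ℝ] ℝ} {b : E → E [⋀^Fin r]→L[ℝ] ℝ} {x : E}
    (ha : DifferentiableAt ℝ a x) (hb : DifferentiableAt ℝ b x) (h : extDeriv a x = 0) :
    extDeriv (fun y => wedge₁ (a y) (b y)) x = -wedge₁ (a x) (extDeriv b x) := by
  let L : (E [⋀^Fin 1]→L[ℝ] ℝ) →L[ℝ] (E →L[ℝ] ℝ) :=
    (ofSubsingletonLIE (𝕜 := ℝ) (E := E) (F := ℝ) (0 : Fin 1)).symm.toContinuousLinearEquiv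
  have hL : HasFDerivAt (fun y => L (a y)) (L ∘L fderiv ℝ a x) x :=
    L.hasFDerivAt.comp x ha.hasFDerivAt
  obtain ⟨D, hD, hD'⟩ := exists_hasFDerivAt_smulRight hL.differentiableAt hb
  have hd : HasFDerivAt (fun y => wedge₁ (a y) (b y)) (alternatizeUncurryFinCLM ℝ E ℝ ∘L D) x :=
    (alternatizeUncurryFinCLM ℝ E ℝ).hasFDerivAt.comp x hD
  rw [extDeriv, hd.fderiv]
  refine (alternatizeUncurryFin_comp_eq_neg (g := (L (a x)).smulRight (fderiv ℝ b x))
    fun v w => ?_).trans ?_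
  · have e : L (fderiv ℝ a x v) w = L (fderiv ℝ a x w) v :=
      fderiv_apply_comm_of_extDeriv_eq_zero h v w
    rw [hD', hD', hL.fderiv]
    change L (a x) w • fderiv ℝ b x v + L (fderiv ℝ a x v) w • b x
        + L (a x) v • fderiv ℝ b x w =
      L (a x) v • fderiv ℝ b x w + L (fderiv ℝ a x w) v • b x
        + L (a x) w • fderiv ℝ b x v
    rw [e]
    abel
  · rw [alternatizeUncurryFinCLM_comp_smulRight]
    rfl

end VectorSpace

/-! ### Exterior calculus on the manifold, read at the centre of a chart -/

namespace DiffForm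

variable {E : Type*} [NormedAddCommGroup E] [NormedSpace ℝ E]
  {M : Type*} [TopologicalSpace M] [ChartedSpace E M] [IsManifold 𝓘(ℝ, E) ∞ M] {r : ℕ}

/-- At the centre of a chart the expression of a form is the form itself. -/
theorem rep_self (s : ∀ x : M, AltFiber E M r x) (x : M) :
    rep x s (extChartAt 𝓘(ℝ, E) x x) = s x := by
  have e : mfderiv 𝓘(ℝ, E) 𝓘(ℝ, E) (extChartAt 𝓘(ℝ, E) x).symm (extChartAt 𝓘(ℝ, E) x x) =
      ContinuousLinearMap.id ℝ E := by
    have h := mfderivWithin_range_extChartAt_symm (I := 𝓘(ℝ, E)) (x := x)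
    rwa [show Set.range 𝓘(ℝ, E) = Set.univ by simp, mfderivWithin_univ] at h
  have aux : ∀ (p : M) (_ : p = x) (A : E →L[ℝ] E), A = ContinuousLinearMap.id ℝ E →
      ContinuousAlternatingMap.compContinuousLinearMap
        (show E [⋀^Fin r]→L[ℝ] ℝ from s p) A = s x := by
    rintro p rfl A rfl; rfl
  exact aux _ (extChartAt_to_inv x) _ e

/-- The chart at `x` has the identity as its derivative at `x`, since `TangentSpace` is trivialized
there by this very chart. -/
theorem extDFun_apply (s : ∀ x : M, AltFiber E M r x) (x : M) :
    extDFun s x = extDeriv (rep x s) (extChartAt 𝓘(ℝ, E) x x) := by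
  have aux : ∀ A : E →L[ℝ] E, A = ContinuousLinearMap.id ℝ E →
      (extDeriv (rep x s) (extChartAt 𝓘(ℝ, E) x x)).compContinuousLinearMap A =
      extDeriv (rep x s) (extChartAt 𝓘(ℝ, E) x x) := by
    rintro A rfl; rfl
  exact aux _ mfderiv_extChartAt_self

theorem rep_differentiableAt (φ : DiffForm E M r) (x : M) :
    DifferentiableAt ℝ (rep x φ) (extChartAt 𝓘(ℝ, E) x x) :=
  (rep_contDiffAt φ.contMDiff x (mem_extChartAt_target x)).differentiableAt (by simp)

theorem d_d (φ : DiffForm E M r) : d (r + 1) (d r φ) = 0 := by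
  refine ContMDiffSection.ext fun x => (extDFun_apply _ x).trans ?_
  have hz := mem_extChartAt_target (I := 𝓘(ℝ, E)) x
  -- The formula is needed on a neighbourhood in one fixed chart, because it is differentiated once
  -- more.
  have h : rep x (extDFun φ) =ᶠ[𝓝 (extChartAt 𝓘(ℝ, E) x x)] extDeriv (rep x φ) := by
    filter_upwards [target_nhds hz] with w hw using rep_extDFun φ.contMDiff x hw
  exact h.extDeriv_eq.trans
    (extDeriv_extDeriv_apply (rep_contDiffAt φ.contMDiff x hz)
      (by rw [minSmoothness_of_isRCLikeNormedField]; exact WithTop.coe_le_coe.2 le_top))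

theorem d_funSMul (f : C^∞⟮𝓘(ℝ, E), M; ℝ⟯) (φ : DiffForm E M r) :
    d r (funSMul f φ) = wedge (d 0 (ofFun f)) φ + funSMul f (d r φ) := by
  refine ContMDiffSection.ext fun x => (extDFun_apply _ x).trans ?_
  have hz := mem_extChartAt_target (I := 𝓘(ℝ, E)) x
  have hf : DifferentiableAt ℝ (f ∘ (extChartAt 𝓘(ℝ, E) x).symm) (extChartAt 𝓘(ℝ, E) x x) := by
    have h1 : ContMDiffAt 𝓘(ℝ, E) 𝓘(ℝ, ℝ) ∞ (f ∘ (extChartAt 𝓘(ℝ, E) x).symm)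
        (extChartAt 𝓘(ℝ, E) x x) :=
      (f.contMDiff _).comp _ ((contMDiffOn_extChartAt_symm x).contMDiffAt (target_nhds hz))
    rw [contMDiffAt_iff_contDiffAt] at h1
    exact h1.differentiableAt (by simp)
  have h := extDeriv_funSMul hf (rep_differentiableAt φ x)
  rw [rep_self φ x, Function.comp_apply, extChartAt_to_inv] at h
  have e1 : d 0 (ofFun f) x = extDeriv (rep x (zeroFormFun f)) (extChartAt 𝓘(ℝ, E) x x) :=
    extDFun_apply _ x
  have e2 : d r φ x = extDeriv (rep x φ) (extChartAt 𝓘(ℝ, E) x x) := extDFun_apply _ x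
  change _ = wedge₁ (E := E) (d 0 (ofFun f) x) (φ x) +
    f x • (show E [⋀^Fin (r + 1)]→L[ℝ] ℝ from d r φ x)
  rw [e1, e2]
  exact h

theorem d_wedge {α : DiffForm E M 1} (hα : d 1 α = 0) (φ : DiffForm E M r) :
    d (r + 1) (wedge α φ) = -wedge α (d r φ) := by
  refine ContMDiffSection.ext fun x => (extDFun_apply _ x).trans ?_
  have h : extDeriv (rep x α) (extChartAt 𝓘(ℝ, E) x x) = 0 := by
    rw [← extDFun_apply]
    exact congrArg (fun β : DiffForm E M 2 => β x) hα
  have key := extDeriv_wedge₁ (rep_differentiableAt α x) (rep_differentiableAt φ x) h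
  rw [rep_self α x] at key
  have e2 : d r φ x = extDeriv (rep x φ) (extChartAt 𝓘(ℝ, E) x x) := extDFun_apply _ x
  change _ = -wedge₁ (E := E) (α x) (d r φ x)
  rw [e2]
  refine Eq.trans ?_ key
  rw [show rep x (wedge α φ : DiffForm E M (r + 1)) = fun y => wedge₁ (rep x α y) (rep x φ y) from
    pullbackFun_wedge _ α φ]

theorem wedge_anticomm (α β : DiffForm E M 1) (φ : DiffForm E M r) :
    wedge α (wedge β φ) = -wedge β (wedge α φ) :=
  ContMDiffSection.ext fun x => wedge₁_anticomm (E := E) (α x) (β x) (φ x)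

end DiffForm
end LichCoh

namespace LichCoh

/-! ### Algebra of the operators `d_f` and `d_{f,θ}` -/

section VectorSpace

variable {E : Type*} [NormedAddCommGroup E] [NormedSpace ℝ E] {r : ℕ}

theorem smul_wedge₁ (c : ℝ) (a : E [⋀^Fin 1]→L[ℝ] ℝ) (b : E [⋀^Fin r]→L[ℝ] ℝ) :
    wedge₁ (c • a) b = c • wedge₁ a b := by
  ext v
  simp only [wedge₁_apply, ContinuousAlternatingMap.smul_apply, smul_eq_mul, Finset.mul_sum]
  refine Finset.sum_congr rfl fun i _ => ?_
  ring

theorem neg_wedge₁ (a : E [⋀^Fin 1]→L[ℝ] ℝ) (b : E [⋀^Fin r]→L[ℝ] ℝ) :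
    wedge₁ (-a) b = -wedge₁ a b := by
  ext v
  simp only [wedge₁_apply, ContinuousAlternatingMap.neg_apply, mul_neg, neg_mul,
    Finset.sum_neg_distrib]

end VectorSpace

namespace DiffForm

variable {E : Type*} [NormedAddCommGroup E] [NormedSpace ℝ E]
  {M : Type*} [TopologicalSpace M] [ChartedSpace E M] [IsManifold 𝓘(ℝ, E) ∞ M] {r : ℕ}

theorem wedge_funSMul_left (f : C^∞⟮𝓘(ℝ, E), M; ℝ⟯) (α : DiffForm E M 1) (φ : DiffForm E M r) :
    wedge (funSMul f α) φ = funSMul f (wedge α φ) :=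
  ContMDiffSection.ext fun x => smul_wedge₁ (E := E) (f x) (α x) (φ x)

theorem wedge_neg_left (α : DiffForm E M 1) (φ : DiffForm E M r) :
    wedge (-α) φ = -wedge α φ :=
  ContMDiffSection.ext fun x => neg_wedge₁ (E := E) (α x) (φ x)

theorem wedge_funSMul_right (f : C^∞⟮𝓘(ℝ, E), M; ℝ⟯) (α : DiffForm E M 1) (φ : DiffForm E M r) :
    wedge α (funSMul f φ) = funSMul f (wedge α φ) :=
  ContMDiffSection.ext fun x => wedge₁_smul (E := E) (f x) (α x) (φ x)

theorem wedge_self (α : DiffForm E M 1) (φ : DiffForm E M r) : wedge α (wedge α φ) = 0 := by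
  have h : (2 : ℝ) • wedge α (wedge α φ) = 0 := by
    rw [two_smul, add_eq_zero_iff_eq_neg]
    exact wedge_anticomm α α φ
  exact (smul_eq_zero_iff_right two_ne_zero).1 h

theorem funSMul_comm (f g : C^∞⟮𝓘(ℝ, E), M; ℝ⟯) (φ : DiffForm E M r) :
    funSMul f (funSMul g φ) = funSMul g (funSMul f φ) :=
  ContMDiffSection.ext fun x => smul_comm (f x) (g x) (φ x)

theorem dFun_apply (f : C^∞⟮𝓘(ℝ, E), M; ℝ⟯) (φ : DiffForm E M r) :
    dFun f r φ = funSMul f (d r φ) - (r : ℝ) • wedge (d 0 (ofFun f)) φ :=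
  rfl

theorem dTwist_apply (f : C^∞⟮𝓘(ℝ, E), M; ℝ⟯) (θ : DiffForm E M 1) (φ : DiffForm E M r) :
    dTwist f θ r φ =
      funSMul f (d r φ) - (r : ℝ) • wedge (d 0 (ofFun f)) φ - funSMul f (wedge θ φ) := by
  rw [← wedge_funSMul_left]
  rfl

theorem dTwist_dTwist (f : C^∞⟮𝓘(ℝ, E), M; ℝ⟯) {θ : DiffForm E M 1} (hθ : d 1 θ = 0)
    (φ : DiffForm E M r) : dTwist f θ (r + 1) (dTwist f θ r φ) = 0 := by
  -- After expansion the coefficient of `f df ∧ dφ` is `1 + r - (r + 1)`, that of `f df ∧ θ ∧ φ` is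
  -- `-1 + (r + 1) - r`, and the two `f² θ ∧ dφ` terms cancel.
  have hf : d 1 (d 0 (ofFun f)) = 0 := d_d _
  simp only [dTwist_apply, map_sub, map_smul, d_funSMul, d_wedge hθ, d_wedge hf, d_d,
    wedge_funSMul_right, wedge_self, wedge_anticomm θ (d 0 (ofFun f)), map_neg, map_add, map_zero]
  push_cast
  module

theorem dFun_zero_ofFun (f g : C^∞⟮𝓘(ℝ, E), M; ℝ⟯) :
    dFun f 0 (ofFun g) = funSMul f (d 0 (ofFun g)) := by
  rw [dFun_apply]
  simp

/-- The Leibniz rule `d_{f,θ}(gφ) = d_f g ∧ φ + g d_{f,θ} φ`. -/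
theorem dTwist_funSMul (f : C^∞⟮𝓘(ℝ, E), M; ℝ⟯) (θ : DiffForm E M 1)
    (g : C^∞⟮𝓘(ℝ, E), M; ℝ⟯) (φ : DiffForm E M r) :
    dTwist f θ r (funSMul g φ) =
      wedge (dFun f 0 (ofFun g)) φ + funSMul g (dTwist f θ r φ) := by
  have h : wedge (dFun f 0 (ofFun g)) φ = funSMul f (wedge (d 0 (ofFun g)) φ) := by
    rw [dFun_zero_ofFun]
    exact wedge_funSMul_left f _ φ
  rw [h]
  simp only [dTwist_apply, map_sub, map_smul, d_funSMul, wedge_funSMul_right, map_add,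
    funSMul_comm g f]
  module

theorem pullback_dFun {N : Type*} [TopologicalSpace N] [ChartedSpace E N] [IsManifold 𝓘(ℝ, E) ∞ N]
    (g : C^∞⟮𝓘(ℝ, E), N; 𝓘(ℝ, E), M⟯) (f : C^∞⟮𝓘(ℝ, E), M; ℝ⟯) (φ : DiffForm E M r) :
    pullback g (dFun f r φ) = dFun (f.comp g) r (pullback g φ) := by
  simp only [dFun_apply, map_sub, map_smul, pullback_funSMul, pullback_d, pullback_wedge]
  rw [← pullback_ofFun]

end DiffForm

/-! ### Pullback along inclusions of open subsets -/

section Inclusion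

open TopologicalSpace (Opens)

variable {E : Type*} [NormedAddCommGroup E] [NormedSpace ℝ E]
  {M : Type*} [TopologicalSpace M] [ChartedSpace E M] [IsManifold 𝓘(ℝ, E) ∞ M] {r : ℕ}

theorem rep_pullback_of_coord_eq_id {N : Type*} [TopologicalSpace N] [ChartedSpace E N]
    [IsManifold 𝓘(ℝ, E) ∞ N] {g : N → M} (hg : ContMDiff 𝓘(ℝ, E) 𝓘(ℝ, E) ∞ g) {x : N}
    (h : (fun z => extChartAt 𝓘(ℝ, E) (g x) (g ((extChartAt 𝓘(ℝ, E) x).symm z)))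
      =ᶠ[𝓝 (extChartAt 𝓘(ℝ, E) x x)] id) (s : ∀ x : M, AltFiber E M r x) :
    rep x (pullbackFun g s) =ᶠ[𝓝 (extChartAt 𝓘(ℝ, E) x x)] rep (g x) s := by
  have h' := rep_pullback_eventually hg s x (g x)
    (mem_extChartAt_target x) (by rw [extChartAt_to_inv]; exact mem_extChartAt_source _)
  refine h'.trans ?_
  -- The derivative of the coordinate expression at `z` requires agreement with `id` near `z`, not
  -- only at `z`.
  filter_upwards [h.eventuallyEq_nhds] with z hz
  rw [hz.fderiv_eq, fderiv_id, show extChartAt 𝓘(ℝ, E) (g x) _ = z from hz.self_of_nhds]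
  rfl

/-- Every tangent space is the model space `E`, so the two fibres can be compared directly; the
charts at `x` and `g x` send their centres to the same point, where `DiffForm.rep_self` reads off
both values. -/
theorem pullbackFun_of_coord_eq_id {N : Type*} [TopologicalSpace N] [ChartedSpace E N]
    [IsManifold 𝓘(ℝ, E) ∞ N] {g : N → M} (hg : ContMDiff 𝓘(ℝ, E) 𝓘(ℝ, E) ∞ g) {x : N}
    (h : (fun z => extChartAt 𝓘(ℝ, E) (g x) (g ((extChartAt 𝓘(ℝ, E) x).symm z)))
      =ᶠ[𝓝 (extChartAt 𝓘(ℝ, E) x x)] id) (s : ∀ x : M, AltFiber E M r x) :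
    pullbackFun g s x = s (g x) := by
  have h1 : extChartAt 𝓘(ℝ, E) x x = extChartAt 𝓘(ℝ, E) (g x) (g x) := by
    have := h.self_of_nhds
    simp only [extChartAt_to_inv] at this
    exact this.symm
  have h2 := (rep_pullback_of_coord_eq_id hg h s).self_of_nhds
  rw [h1, DiffForm.rep_self, ← h1] at h2
  exact (DiffForm.rep_self _ x).symm.trans h2

/-- The preferred chart of `U` at `x` is the restriction of the preferred chart of `M` at the same
point. Restriction to open subsets is therefore plain evaluation. -/
theorem coord_incl (U : Opens M) (x : U) :
    (fun z => extChartAt 𝓘(ℝ, E) x.1 ((extChartAt 𝓘(ℝ, E) x).symm z).1)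
      =ᶠ[𝓝 (extChartAt 𝓘(ℝ, E) x x)] id := by
  filter_upwards [target_nhds (mem_extChartAt_target (I := 𝓘(ℝ, E)) x)] with z hz
  exact (extChartAt 𝓘(ℝ, E) x).right_inv hz

theorem resForm_apply (U : Opens M) (φ : DiffForm E M r) (x : U) : resForm U φ x = φ x.1 :=
  pullbackFun_of_coord_eq_id (contMDiff_subtype_val (I := 𝓘(ℝ, E))) (coord_incl U x) φ

theorem pullback_inclLE_apply {U V : Opens M} (h : U ≤ V) (φ : DiffForm E V r) (x : U) :
    DiffForm.pullback (inclLE h) φ x = φ (Opens.inclusion h x) :=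
  pullbackFun_of_coord_eq_id (contMDiff_inclusion (I := 𝓘(ℝ, E)) h) (coord_incl U x) φ

theorem contMDiffAt_of_pullback_incl {U : Opens M} {s : ∀ x : M, AltFiber E M r x} (x : U)
    (h : ContMDiffAt 𝓘(ℝ, E) (𝓘(ℝ, E).prod 𝓘(ℝ, E [⋀^Fin r]→L[ℝ] ℝ)) ∞
      (fun x => Bundle.TotalSpace.mk' (E [⋀^Fin r]→L[ℝ] ℝ) x
        (pullbackFun (Subtype.val : U → M) s x)) x) :
    ContMDiffAt 𝓘(ℝ, E) (𝓘(ℝ, E).prod 𝓘(ℝ, E [⋀^Fin r]→L[ℝ] ℝ)) ∞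
      (fun x => Bundle.TotalSpace.mk' (E [⋀^Fin r]→L[ℝ] ℝ) x (s x)) x.1 := by
  rw [contMDiffAt_form_iff] at h ⊢
  exact h.congr_of_eventuallyEq (rep_pullback_of_coord_eq_id contMDiff_subtype_val
    (coord_incl U x) s).symm

end Inclusion
end LichCoh

namespace LichCoh

open TopologicalSpace (Opens)

variable {E : Type*} [NormedAddCommGroup E] [NormedSpace ℝ E]
  {M : Type*} [TopologicalSpace M] [ChartedSpace E M] [IsManifold 𝓘(ℝ, E) ∞ M] {r : ℕ}

/-! ### Gluing and extension by zero -/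

section Glueing

/-- A section that coincides with a smooth form on an open set is smooth there. -/
theorem contMDiffAt_of_eq_on_opens {W : Opens M} {s : ∀ x : M, AltFiber E M r x}
    (φ : DiffForm E W r) (h : ∀ y : W, s y.1 = φ y) (x : W) :
    ContMDiffAt 𝓘(ℝ, E) (𝓘(ℝ, E).prod 𝓘(ℝ, E [⋀^Fin r]→L[ℝ] ℝ)) ∞
      (fun x => Bundle.TotalSpace.mk' (E [⋀^Fin r]→L[ℝ] ℝ) x (s x)) x.1 := by
  refine contMDiffAt_of_pullback_incl x ?_
  have e : pullbackFun (Subtype.val : W → M) s = φ := by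
    funext y
    exact (pullbackFun_of_coord_eq_id (contMDiff_subtype_val (I := 𝓘(ℝ, E))) (coord_incl W y) s).trans
      (h y)
  rw [e]
  exact φ.contMDiff x

theorem isSmoothForm_pullback_incl {U : Opens M} {s : ∀ x : M, AltFiber E M r x}
    (h : ∀ x : U, ContMDiffAt 𝓘(ℝ, E) (𝓘(ℝ, E).prod 𝓘(ℝ, E [⋀^Fin r]→L[ℝ] ℝ)) ∞
      (fun x => Bundle.TotalSpace.mk' (E [⋀^Fin r]→L[ℝ] ℝ) x (s x)) x.1) :
    IsSmoothForm (pullbackFun (Subtype.val : U → M) s) := by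
  intro x
  have hx := h x
  rw [contMDiffAt_form_iff] at hx ⊢
  exact hx.congr_of_eventuallyEq
    (rep_pullback_of_coord_eq_id contMDiff_subtype_val (coord_incl U x) s)

/-- Sheaf gluing: smoothness is local, and near each point the glued section coincides with `a` or
with `b`. -/
theorem exists_resForm_eq {U V : Opens M} (hUV : U ⊔ V = ⊤)
    (a : DiffForm E U r) (b : DiffForm E V r)
    (h : DiffForm.pullback (inclLE (inf_le_left : U ⊓ V ≤ U)) a =
      DiffForm.pullback (inclLE (inf_le_right : U ⊓ V ≤ V)) b) :
    ∃ η : DiffForm E M r, resForm U η = a ∧ resForm V η = b := by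
  classical
  let s : ∀ x : M, AltFiber E M r x := fun x =>
    if hx : x ∈ U then (show E [⋀^Fin r]→L[ℝ] ℝ from a ⟨x, hx⟩)
    else if hx : x ∈ V then (show E [⋀^Fin r]→L[ℝ] ℝ from b ⟨x, hx⟩) else 0
  have hU : ∀ y : U, s y.1 = a y := fun y => dif_pos y.2
  have hV : ∀ y : V, s y.1 = b y := by
    intro y
    by_cases hy : y.1 ∈ U
    · have e := congrArg (fun φ : DiffForm E ↥(U ⊓ V) r => φ ⟨y.1, hy, y.2⟩) h
      simp only [pullback_inclLE_apply] at e
      exact (hU ⟨y.1, hy⟩).trans e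
    · exact (dif_neg hy).trans (dif_pos y.2)
  have hs : IsSmoothForm s := by
    intro x
    rcases (by rw [← Opens.coe_sup, hUV]; trivial : x ∈ (U : Set M) ∪ V) with hx | hx
    · exact contMDiffAt_of_eq_on_opens a hU ⟨x, hx⟩
    · exact contMDiffAt_of_eq_on_opens b hV ⟨x, hx⟩
  refine ⟨⟨s, hs⟩, ContMDiffSection.ext fun y => ?_, ContMDiffSection.ext fun y => ?_⟩
  · exact (resForm_apply U _ y).trans (hU y)
  · exact (resForm_apply V _ y).trans (hV y)

theorem eq_of_resForm_eq {U V : Opens M} (hUV : U ⊔ V = ⊤) {η ζ : DiffForm E M r}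
    (hU : resForm U η = resForm U ζ) (hV : resForm V η = resForm V ζ) : η = ζ := by
  refine ContMDiffSection.ext fun x => ?_
  rcases (by rw [← Opens.coe_sup, hUV]; trivial : x ∈ (U : Set M) ∪ V) with hx | hx
  · rw [← resForm_apply U η ⟨x, hx⟩, hU, resForm_apply]
  · rw [← resForm_apply V η ⟨x, hx⟩, hV, resForm_apply]

/-- If the support of `g` meets `X` inside `W`, then `g σ` extends by zero from `X ∩ W` to `X`. -/
theorem exists_extension_smul {X W : Opens M} (g : C^∞⟮𝓘(ℝ, E), M; ℝ⟯)
    (hg : ∀ x ∈ X, x ∈ tsupport g → x ∈ W) (σ : DiffForm E W r) :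
    ∃ a : DiffForm E X r, (∀ (x : X) (hx : x.1 ∈ W),
      (show E [⋀^Fin r]→L[ℝ] ℝ from a x) = g x.1 • (show E [⋀^Fin r]→L[ℝ] ℝ from σ ⟨x.1, hx⟩)) ∧
      ∀ x : X, x.1 ∉ tsupport g → a x = 0 := by
  classical
  let s : ∀ x : M, AltFiber E M r x := fun x =>
    if hx : x ∈ W then g x • (show E [⋀^Fin r]→L[ℝ] ℝ from σ ⟨x, hx⟩) else 0
  have hW : ∀ y : W, s y.1 = DiffForm.funSMul (resFun W g) σ y := fun y => dif_pos y.2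
  let T : Opens M := ⟨(tsupport g)ᶜ, (isClosed_tsupport g).isOpen_compl⟩
  have h0 : ∀ y : M, y ∉ tsupport g → s y = 0 := by
    intro y hy
    by_cases h : y ∈ W
    · refine (dif_pos h).trans ?_
      rw [image_eq_zero_of_notMem_tsupport hy]
      exact zero_smul ℝ (show E [⋀^Fin r]→L[ℝ] ℝ from σ ⟨y, h⟩)
    · exact dif_neg h
  have hT : ∀ y : T, s y.1 = (0 : DiffForm E T r) y := fun y => h0 y.1 y.2
  -- Points of `X` in the support of `g` lie in the open set `W`, where `s = g σ`; the others lie in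
  -- the open complement of the support, where `s = 0`.
  have hs := isSmoothForm_pullback_incl (U := X) (s := s) fun x => by
    by_cases h : x.1 ∈ tsupport g
    · exact contMDiffAt_of_eq_on_opens _ hW ⟨x.1, hg x.1 x.2 h⟩
    · exact contMDiffAt_of_eq_on_opens _ hT ⟨x.1, h⟩
  have e : ∀ x : X, pullbackFun (Subtype.val : X → M) s x = s x.1 := fun x =>
    pullbackFun_of_coord_eq_id (contMDiff_subtype_val (I := 𝓘(ℝ, E))) (coord_incl X x) s
  exact ⟨⟨_, hs⟩, fun x hx => (e x).trans (dif_pos hx), fun x hx => (e x).trans (h0 _ hx)⟩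

end Glueing

/-! ### Compatibility with restriction, and locality -/

section Restriction

theorem resForm_dTwist (U : Opens M) (f : C^∞⟮𝓘(ℝ, E), M; ℝ⟯) (θ : DiffForm E M 1)
    (φ : DiffForm E M r) :
    resForm U (DiffForm.dTwist f θ r φ) =
      DiffForm.dTwist (resFun U f) (resForm U θ) r (resForm U φ) :=
  DiffForm.pullback_dTwist (incl U) f θ φ

theorem pullback_inclLE_dTwist {W U : Opens M} (h : W ≤ U) (f : C^∞⟮𝓘(ℝ, E), M; ℝ⟯)
    (θ : DiffForm E M 1) (φ : DiffForm E U r) :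
    DiffForm.pullback (inclLE h) (DiffForm.dTwist (resFun U f) (resForm U θ) r φ) =
      DiffForm.dTwist (resFun W f) (resForm W θ) r (DiffForm.pullback (inclLE h) φ) := by
  rw [DiffForm.pullback_dTwist, ← resForm_le h θ]
  rfl

/-- The operator `d_{f,θ}` is local. -/
theorem dTwist_apply_eq_zero {U T : Opens M} (f : C^∞⟮𝓘(ℝ, E), M; ℝ⟯) (θ : DiffForm E M 1)
    (a : DiffForm E U r) (ha : ∀ x : U, x.1 ∈ T → a x = 0) (x : U) (hx : x.1 ∈ T) :
    DiffForm.dTwist (resFun U f) (resForm U θ) r a x = 0 := by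
  have h0 : DiffForm.pullback (inclLE (inf_le_left : U ⊓ T ≤ U)) a = 0 :=
    ContMDiffSection.ext fun y => (pullback_inclLE_apply _ a y).trans (ha _ y.2.2)
  have h1 := pullback_inclLE_dTwist (inf_le_left : U ⊓ T ≤ U) f θ a
  rw [h0, map_zero] at h1
  have h2 := congrArg (fun φ : DiffForm E ↥(U ⊓ T) (r + 1) => φ ⟨x.1, x.2, hx⟩) h1
  simp only [pullback_inclLE_apply] at h2
  exact h2

theorem d_resForm_eq_zero (U : Opens M) {θ : DiffForm E M 1} (hθ : DiffForm.d 1 θ = 0) :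
    DiffForm.d 1 (resForm U θ) = 0 := by
  have h := DiffForm.pullback_d (incl U) θ
  rw [hθ, map_zero] at h
  exact h.symm

theorem d_ofFun_one : DiffForm.d 0 (DiffForm.ofFun (1 : C^∞⟮𝓘(ℝ, E), M; ℝ⟯)) = 0 := by
  refine ContMDiffSection.ext fun x => (DiffForm.extDFun_apply _ x).trans ?_
  have h : rep x (DiffForm.ofFun (1 : C^∞⟮𝓘(ℝ, E), M; ℝ⟯)) =
      fun _ : E => ContinuousAlternatingMap.constOfIsEmpty ℝ E (Fin 0) (1 : ℝ) := rfl
  rw [h, extDeriv_constOfIsEmpty, fderiv_fun_const]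
  rfl

end Restriction
end LichCoh

namespace LichCoh

open TopologicalSpace (Opens)

variable {E : Type*} [NormedAddCommGroup E] [NormedSpace ℝ E]
  {M : Type*} [TopologicalSpace M] [ChartedSpace E M] [IsManifold 𝓘(ℝ, E) ∞ M] {r : ℕ}
  {f : C^∞⟮𝓘(ℝ, E), M; ℝ⟯} {θ : DiffForm E M 1} {U V : Opens M}

/-! ### Cohomology classes and their representatives -/

section Classes

theorem exactForms_le (hθ : DiffForm.d 1 θ = 0) :
    ∀ {r : ℕ} {φ : DiffForm E M r}, φ ∈ exactForms f θ r → φ ∈ closedForms f θ r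
  | 0, φ, h => by
    rw [show φ = 0 from h]
    exact Submodule.zero_mem _
  | r + 1, φ, h => by
    obtain ⟨ψ, rfl⟩ := h
    exact DiffForm.dTwist_dTwist f hθ ψ

theorem Cohomology.mk_eq_zero (φ : closedForms f θ r) :
    Cohomology.mk f θ r φ = 0 ↔ (φ : DiffForm E M r) ∈ exactForms f θ r :=
  (Submodule.Quotient.mk_eq_zero _).trans Iff.rfl

theorem Cohomology.mk_eq_mk (φ ψ : closedForms f θ r) :
    Cohomology.mk f θ r φ = Cohomology.mk f θ r ψ ↔
      (φ - ψ : DiffForm E M r) ∈ exactForms f θ r := by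
  rw [← sub_eq_zero, ← map_sub, Cohomology.mk_eq_zero]
  rfl

theorem Cohomology.exists_mk_eq (c : Cohomology f θ r) : ∃ φ, Cohomology.mk f θ r φ = c :=
  Submodule.mkQ_surjective _ c

end Classes

/-! ### The zigzag relation and the connecting homomorphism -/

section Connecting

/-- The restriction of forms from `U` to `U ∩ V`. -/
noncomputable def resLeft (U V : Opens M) : DiffForm E U r →ₗ[ℝ] DiffForm E ↥(U ⊓ V) r :=
  DiffForm.pullback (inclLE inf_le_left)

/-- The restriction of forms from `V` to `U ∩ V`. -/
noncomputable def resRight (U V : Opens M) : DiffForm E V r →ₗ[ℝ] DiffForm E ↥(U ⊓ V) r :=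
  DiffForm.pullback (inclLE inf_le_right)

theorem resLeft_resForm (φ : DiffForm E M r) :
    resLeft U V (resForm U φ) = resForm (U ⊓ V) φ :=
  (resForm_le inf_le_left φ).symm

theorem resRight_resForm (φ : DiffForm E M r) :
    resRight U V (resForm V φ) = resForm (U ⊓ V) φ :=
  (resForm_le inf_le_right φ).symm

theorem resLeft_dTwist (a : DiffForm E U r) :
    resLeft U V (DiffForm.dTwist (resFun U f) (resForm U θ) r a) =
      DiffForm.dTwist (resFun (U ⊓ V) f) (resForm (U ⊓ V) θ) r (resLeft U V a) :=
  pullback_inclLE_dTwist inf_le_left f θ a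

theorem resRight_dTwist (b : DiffForm E V r) :
    resRight U V (DiffForm.dTwist (resFun V f) (resForm V θ) r b) =
      DiffForm.dTwist (resFun (U ⊓ V) f) (resForm (U ⊓ V) θ) r (resRight U V b) :=
  pullback_inclLE_dTwist inf_le_right f θ b

variable (f θ U V) in
/-- The zigzag relation defining the connecting homomorphism: `σ = a - b` on `U ∩ V`, and `η`
restricts to `d_{f,θ} a` on `U` and to `d_{f,θ} b` on `V`. -/
def IsConnecting (σ : DiffForm E ↥(U ⊓ V) r) (η : DiffForm E M (r + 1)) : Prop :=
  ∃ (a : DiffForm E U r) (b : DiffForm E V r), resLeft U V a - resRight U V b = σ ∧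
    resForm U η = DiffForm.dTwist (resFun U f) (resForm U θ) r a ∧
    resForm V η = DiffForm.dTwist (resFun V f) (resForm V θ) r b

namespace IsConnecting

variable {σ σ' : DiffForm E ↥(U ⊓ V) r} {η η' : DiffForm E M (r + 1)}

theorem add (h : IsConnecting f θ U V σ η) (h' : IsConnecting f θ U V σ' η') :
    IsConnecting f θ U V (σ + σ') (η + η') := by
  obtain ⟨a, b, rfl, hU, hV⟩ := h
  obtain ⟨a', b', rfl, hU', hV'⟩ := h'
  refine ⟨a + a', b + b', ?_, ?_, ?_⟩
  · simp only [map_add]; abel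
  · simp only [map_add, hU, hU']
  · simp only [map_add, hV, hV']

theorem smul (c : ℝ) (h : IsConnecting f θ U V σ η) : IsConnecting f θ U V (c • σ) (c • η) := by
  obtain ⟨a, b, rfl, hU, hV⟩ := h
  refine ⟨c • a, c • b, ?_, ?_, ?_⟩
  · simp only [map_smul, smul_sub]
  · simp only [map_smul, hU]
  · simp only [map_smul, hV]

theorem sub (h : IsConnecting f θ U V σ η) (h' : IsConnecting f θ U V σ' η') :
    IsConnecting f θ U V (σ - σ') (η - η') := by
  have := h.add (h'.smul (-1))
  simpa only [neg_smul, one_smul, ← sub_eq_add_neg] using this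

/-- Closedness is local, and `η` is exact on `U` and on `V` separately. -/
theorem mem_closedForms (hθ : DiffForm.d 1 θ = 0) (hUV : U ⊔ V = ⊤)
    (h : IsConnecting f θ U V σ η) : η ∈ closedForms f θ (r + 1) := by
  obtain ⟨a, b, -, hU, hV⟩ := h
  refine LinearMap.mem_ker.2 (eq_of_resForm_eq hUV ?_ ?_)
  · rw [resForm_dTwist, hU, DiffForm.dTwist_dTwist _ (d_resForm_eq_zero U hθ), map_zero]
  · rw [resForm_dTwist, hV, DiffForm.dTwist_dTwist _ (d_resForm_eq_zero V hθ), map_zero]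

end IsConnecting

/-- The difference map `Ωʳ(U) × Ωʳ(V) → Ωʳ(U ∩ V)` is onto. -/
def DifferenceSurjective (E : Type*) [NormedAddCommGroup E] [NormedSpace ℝ E] {M : Type*}
    [TopologicalSpace M] [ChartedSpace E M] [IsManifold 𝓘(ℝ, E) ∞ M] (U V : Opens M) : Prop :=
  ∀ (r : ℕ) (σ : DiffForm E ↥(U ⊓ V) r), ∃ (a : DiffForm E U r) (b : DiffForm E V r),
    resLeft U V a - resRight U V b = σ

/-- Split a primitive of `σ` as a difference and differentiate the two pieces. In degree `0` the
only exact form is zero. -/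
theorem exists_exact_difference (hs : DifferenceSurjective E U V) :
    ∀ {r : ℕ} {σ : DiffForm E ↥(U ⊓ V) r},
      σ ∈ exactForms (resFun (U ⊓ V) f) (resForm (U ⊓ V) θ) r →
      ∃ a ∈ exactForms (resFun U f) (resForm U θ) r,
        ∃ b ∈ exactForms (resFun V f) (resForm V θ) r, resLeft U V a - resRight U V b = σ
  | 0, σ, h => by
    rw [show σ = 0 from h]
    exact ⟨0, Submodule.zero_mem _, 0, Submodule.zero_mem _, by simp⟩
  | r + 1, σ, h => by
    obtain ⟨τ, rfl⟩ := h
    obtain ⟨a, b, rfl⟩ := hs r τ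
    refine ⟨_, ⟨a, rfl⟩, _, ⟨b, rfl⟩, ?_⟩
    rw [resLeft_dTwist, resRight_dTwist, map_sub]

/-- This makes the connecting map well defined, both in the choice of `a, b` (case `σ = 0`) and in
the choice of representative. Subtracting exact forms `a', b'` with `a' - b' = σ` makes `a - a'` and
`b - b'` agree on the overlap; they glue to a primitive of `η`, since `a'` and `b'` are closed. -/
theorem IsConnecting.mem_exactForms (hθ : DiffForm.d 1 θ = 0) (hUV : U ⊔ V = ⊤)
    (hs : DifferenceSurjective E U V) {σ : DiffForm E ↥(U ⊓ V) r} {η : DiffForm E M (r + 1)}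
    (h : IsConnecting f θ U V σ η)
    (hσ : σ ∈ exactForms (resFun (U ⊓ V) f) (resForm (U ⊓ V) θ) r) :
    η ∈ exactForms f θ (r + 1) := by
  obtain ⟨a, b, hab, hU, hV⟩ := h
  obtain ⟨a', ha', b', hb', hab'⟩ := exists_exact_difference hs hσ
  have hz : resLeft U V (a - a') = resRight U V (b - b') := by
    rw [← sub_eq_zero]
    calc _ = (resLeft U V a - resRight U V b) - (resLeft U V a' - resRight U V b') := by
          simp only [map_sub]; abel
      _ = 0 := by rw [hab, hab', sub_self]
  obtain ⟨ζ, hζU, hζV⟩ := exists_resForm_eq hUV _ _ hz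
  have ha0 : DiffForm.dTwist (resFun U f) (resForm U θ) r a' = 0 :=
    exactForms_le (d_resForm_eq_zero U hθ) ha'
  have hb0 : DiffForm.dTwist (resFun V f) (resForm V θ) r b' = 0 :=
    exactForms_le (d_resForm_eq_zero V hθ) hb'
  refine ⟨ζ, eq_of_resForm_eq hUV ?_ ?_⟩
  · rw [resForm_dTwist, hζU, map_sub, ha0, sub_zero, hU]
  · rw [resForm_dTwist, hζV, map_sub, hb0, sub_zero, hV]

/-- Closedness of `a - b` says precisely that `d_{f,θ} a` and `d_{f,θ} b` agree on `U ∩ V`, so they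
glue. -/
theorem exists_isConnecting_of_difference (hUV : U ⊔ V = ⊤) (a : DiffForm E U r)
    (b : DiffForm E V r)
    (h : resLeft U V a - resRight U V b ∈ closedForms (resFun (U ⊓ V) f) (resForm (U ⊓ V) θ) r) :
    ∃ η : DiffForm E M (r + 1),
      resForm U η = DiffForm.dTwist (resFun U f) (resForm U θ) r a ∧
      resForm V η = DiffForm.dTwist (resFun V f) (resForm V θ) r b := by
  refine exists_resForm_eq hUV _ _ ?_
  change resLeft U V _ = resRight U V _
  have h' := LinearMap.mem_ker.1 h
  rw [map_sub, sub_eq_zero] at h'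
  rw [resLeft_dTwist, resRight_dTwist, h']

/-- The zigzag relation descends to a linear map in cohomology, the connecting homomorphism. -/
theorem exists_connectingHom (hθ : DiffForm.d 1 θ = 0) (hUV : U ⊔ V = ⊤)
    (hs : DifferenceSurjective E U V) (r : ℕ) :
    ∃ δ : Cohomology (resFun (U ⊓ V) f) (resForm (U ⊓ V) θ) r →ₗ[ℝ] Cohomology f θ (r + 1),
      ∀ (σ : closedForms (resFun (U ⊓ V) f) (resForm (U ⊓ V) θ) r) (η : closedForms f θ (r + 1)),
        IsConnecting f θ U V (σ : DiffForm E ↥(U ⊓ V) r) (η : DiffForm E M (r + 1)) →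
        δ (Cohomology.mk _ _ r σ) = Cohomology.mk f θ (r + 1) η := by
  have ex : ∀ σ : closedForms (resFun (U ⊓ V) f) (resForm (U ⊓ V) θ) r,
      ∃ η : closedForms f θ (r + 1),
        IsConnecting f θ U V (σ : DiffForm E ↥(U ⊓ V) r) (η : DiffForm E M (r + 1)) := by
    intro σ
    obtain ⟨a, b, hab⟩ := hs r σ
    obtain ⟨η, hU, hV⟩ := exists_isConnecting_of_difference (f := f) (θ := θ) hUV a b
      (by rw [hab]; exact σ.2)
    have h : IsConnecting f θ U V (σ : DiffForm E ↥(U ⊓ V) r) η := ⟨a, b, hab, hU, hV⟩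
    exact ⟨⟨η, h.mem_closedForms hθ hUV⟩, h⟩
  choose c hc using ex
  -- The choice `c` need not be linear, but its class is determined: two zigzags from the same `σ`
  -- differ by a zigzag from `0`. Linearity then follows from that of the relation.
  have uniq : ∀ (σ : closedForms (resFun (U ⊓ V) f) (resForm (U ⊓ V) θ) r)
      (η : closedForms f θ (r + 1)),
      IsConnecting f θ U V (σ : DiffForm E ↥(U ⊓ V) r) (η : DiffForm E M (r + 1)) →
      Cohomology.mk f θ (r + 1) (c σ) = Cohomology.mk f θ (r + 1) η := by
    intro σ η h
    rw [Cohomology.mk_eq_mk]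
    refine ((hc σ).sub h).mem_exactForms hθ hUV hs ?_
    rw [sub_self]
    exact Submodule.zero_mem _
  let δ₀ : closedForms (resFun (U ⊓ V) f) (resForm (U ⊓ V) θ) r →ₗ[ℝ] Cohomology f θ (r + 1) :=
    { toFun := fun σ => Cohomology.mk f θ (r + 1) (c σ)
      map_add' := fun σ τ => by
        rw [← map_add]
        exact uniq _ _ ((hc σ).add (hc τ))
      map_smul' := fun k σ => by
        rw [← map_smul]
        exact uniq _ _ ((hc σ).smul k) }
  refine ⟨Submodule.liftQ _ δ₀ fun σ hσ => ?_, fun σ η h => uniq σ η h⟩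
  exact (Cohomology.mk_eq_zero _).2 ((hc σ).mem_exactForms hθ hUV hs hσ)

end Connecting

/-! ### Exactness of the sequence -/

section Exactness

/-- The restriction of closed forms to an open subset. -/
noncomputable def closedForms.res (U : Opens M) (φ : closedForms f θ r) :
    closedForms (resFun U f) (resForm U θ) r :=
  closedForms.pullback (incl U) rfl rfl r φ

theorem alphaStar_mk_eq (φ : closedForms f θ r) :
    alphaStar f θ U V r (Cohomology.mk f θ r φ) =
      (Cohomology.mk _ _ r (closedForms.res U φ), Cohomology.mk _ _ r (closedForms.res V φ)) :=
  rfl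

theorem alphaStar_mk_eq_zero (φ : closedForms f θ r) :
    alphaStar f θ U V r (Cohomology.mk f θ r φ) = 0 ↔
      resForm U (φ : DiffForm E M r) ∈ exactForms (resFun U f) (resForm U θ) r ∧
        resForm V (φ : DiffForm E M r) ∈ exactForms (resFun V f) (resForm V θ) r := by
  rw [alphaStar_mk_eq, Prod.mk_eq_zero, Cohomology.mk_eq_zero, Cohomology.mk_eq_zero]
  rfl

theorem alphaStar_injective (hUV : U ⊔ V = ⊤) : Function.Injective (alphaStar f θ U V 0) := by
  rw [injective_iff_map_eq_zero]
  intro c hc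
  obtain ⟨φ, rfl⟩ := Cohomology.exists_mk_eq c
  rw [alphaStar_mk_eq_zero] at hc
  rw [Cohomology.mk_eq_zero]
  -- `exactForms` is `⊥` in degree `0`, so a vanishing class means a vanishing form.
  have hU : resForm U (φ : DiffForm E M 0) = 0 := hc.1
  have hV : resForm V (φ : DiffForm E M 0) = 0 := hc.2
  exact eq_of_resForm_eq hUV (hU.trans (map_zero _).symm) (hV.trans (map_zero _).symm)

theorem exact_alphaStar_betaStar (hθ : DiffForm.d 1 θ = 0) (hUV : U ⊔ V = ⊤)
    (hs : DifferenceSurjective E U V) (r : ℕ) :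
    Function.Exact (alphaStar f θ U V r) (betaStar f θ U V r) := by
  rintro ⟨c₁, c₂⟩
  constructor
  · intro h
    obtain ⟨a, rfl⟩ := Cohomology.exists_mk_eq c₁
    obtain ⟨b, rfl⟩ := Cohomology.exists_mk_eq c₂
    rw [betaStar_mk, Cohomology.mk_eq_zero] at h
    -- Correcting `a` and `b` by these exact forms keeps their classes and makes them equal on the
    -- overlap, hence restrictions of one closed form on `M`.
    obtain ⟨a', ha', b', hb', hab'⟩ := exists_exact_difference hs h
    have hz : resLeft U V ((a : DiffForm E U r) - a') = resRight U V ((b : DiffForm E V r) - b') := by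
      have e : resLeft U V a' - resRight U V b' = resLeft U V a - resRight U V b := hab'
      rw [map_sub, map_sub, sub_eq_sub_iff_sub_eq_sub, ← e]
    obtain ⟨ζ, hζU, hζV⟩ := exists_resForm_eq hUV _ _ hz
    have ha0 := exactForms_le (d_resForm_eq_zero U hθ) ha'
    have hb0 := exactForms_le (d_resForm_eq_zero V hθ) hb'
    have hζ : ζ ∈ closedForms f θ r := by
      refine LinearMap.mem_ker.2 (eq_of_resForm_eq hUV ?_ ?_)
      · rw [resForm_dTwist, hζU, map_zero]
        exact Submodule.sub_mem _ a.2 ha0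
      · rw [resForm_dTwist, hζV, map_zero]
        exact Submodule.sub_mem _ b.2 hb0
    refine ⟨Cohomology.mk f θ r ⟨ζ, hζ⟩, ?_⟩
    rw [alphaStar_mk_eq]
    refine Prod.ext ((Cohomology.mk_eq_mk _ _).2 ?_) ((Cohomology.mk_eq_mk _ _).2 ?_)
    · change resForm U ζ - (a : DiffForm E U r) ∈ exactForms (resFun U f) (resForm U θ) r
      rw [hζU, sub_sub_cancel_left]
      exact Submodule.neg_mem _ ha'
    · change resForm V ζ - (b : DiffForm E V r) ∈ exactForms (resFun V f) (resForm V θ) r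
      rw [hζV, sub_sub_cancel_left]
      exact Submodule.neg_mem _ hb'
  · rintro ⟨c, hc⟩
    obtain ⟨φ, rfl⟩ := Cohomology.exists_mk_eq c
    rw [← hc, alphaStar_mk_eq, betaStar_mk, Cohomology.mk_eq_zero]
    change resLeft U V (resForm U (φ : DiffForm E M r)) -
      resRight U V (resForm V (φ : DiffForm E M r)) ∈ _
    rw [resLeft_resForm, resRight_resForm, sub_self]
    exact Submodule.zero_mem _

variable {δ : Cohomology (resFun (U ⊓ V) f) (resForm (U ⊓ V) θ) r →ₗ[ℝ] Cohomology f θ (r + 1)}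

theorem exact_betaStar_connecting (hθ : DiffForm.d 1 θ = 0) (hUV : U ⊔ V = ⊤)
    (hs : DifferenceSurjective E U V)
    (hδ : ∀ (σ : closedForms (resFun (U ⊓ V) f) (resForm (U ⊓ V) θ) r)
      (η : closedForms f θ (r + 1)),
        IsConnecting f θ U V (σ : DiffForm E ↥(U ⊓ V) r) (η : DiffForm E M (r + 1)) →
        δ (Cohomology.mk _ _ r σ) = Cohomology.mk f θ (r + 1) η) :
    Function.Exact (betaStar f θ U V r) δ := by
  intro c
  constructor
  · intro h
    obtain ⟨σ, rfl⟩ := Cohomology.exists_mk_eq c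
    obtain ⟨a, b, hab⟩ := hs r σ
    obtain ⟨η, hU, hV⟩ := exists_isConnecting_of_difference (f := f) (θ := θ) hUV a b
      (by rw [hab]; exact σ.2)
    have hc : IsConnecting f θ U V (σ : DiffForm E ↥(U ⊓ V) r) η := ⟨a, b, hab, hU, hV⟩
    rw [hδ σ ⟨η, hc.mem_closedForms hθ hUV⟩ hc, Cohomology.mk_eq_zero] at h
    obtain ⟨ζ, hζ⟩ := h
    have hζ' : DiffForm.dTwist f θ r ζ = η := hζ
    -- Removing the global primitive `ζ` of `η` from both `a` and `b` makes them closed and leaves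
    -- their difference `σ` unchanged.
    have ha : a - resForm U ζ ∈ closedForms (resFun U f) (resForm U θ) r := by
      refine LinearMap.mem_ker.2 ?_
      rw [map_sub, ← resForm_dTwist, hζ', hU, sub_self]
    have hb : b - resForm V ζ ∈ closedForms (resFun V f) (resForm V θ) r := by
      refine LinearMap.mem_ker.2 ?_
      rw [map_sub, ← resForm_dTwist, hζ', hV, sub_self]
    refine ⟨(Cohomology.mk _ _ r ⟨_, ha⟩, Cohomology.mk _ _ r ⟨_, hb⟩), ?_⟩
    rw [betaStar_mk]
    congr 1
    apply Subtype.ext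
    change resLeft U V (a - resForm U ζ) - resRight U V (b - resForm V ζ) = _
    rw [map_sub, map_sub, resLeft_resForm, resRight_resForm, sub_sub_sub_cancel_right, hab]
  · rintro ⟨⟨c₁, c₂⟩, rfl⟩
    obtain ⟨a, rfl⟩ := Cohomology.exists_mk_eq c₁
    obtain ⟨b, rfl⟩ := Cohomology.exists_mk_eq c₂
    -- Since `a` and `b` are closed, their difference is related to `η = 0`.
    rw [betaStar_mk, hδ _ 0 ?_, map_zero]
    refine ⟨a, b, rfl, ?_, ?_⟩
    · exact (map_zero _).trans a.2.symm
    · exact (map_zero _).trans b.2.symm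

theorem exact_connecting_alphaStar (hθ : DiffForm.d 1 θ = 0) (hUV : U ⊔ V = ⊤)
    (hs : DifferenceSurjective E U V)
    (hδ : ∀ (σ : closedForms (resFun (U ⊓ V) f) (resForm (U ⊓ V) θ) r)
      (η : closedForms f θ (r + 1)),
        IsConnecting f θ U V (σ : DiffForm E ↥(U ⊓ V) r) (η : DiffForm E M (r + 1)) →
        δ (Cohomology.mk _ _ r σ) = Cohomology.mk f θ (r + 1) η) :
    Function.Exact δ (alphaStar f θ U V (r + 1)) := by
  intro c
  constructor
  · intro h
    obtain ⟨η, rfl⟩ := Cohomology.exists_mk_eq c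
    rw [alphaStar_mk_eq_zero] at h
    obtain ⟨⟨a, ha⟩, ⟨b, hb⟩⟩ := h
    have hU : DiffForm.dTwist (resFun U f) (resForm U θ) r a = resForm U (η : DiffForm E M _) := ha
    have hV : DiffForm.dTwist (resFun V f) (resForm V θ) r b = resForm V (η : DiffForm E M _) := hb
    -- The preimage under `δ` is the difference of the local primitives of `η`; both differentiate
    -- to `η` on the overlap, so the difference is closed.
    have hσ : resLeft U V a - resRight U V b ∈
        closedForms (resFun (U ⊓ V) f) (resForm (U ⊓ V) θ) r := by
      refine LinearMap.mem_ker.2 ?_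
      rw [map_sub, ← resLeft_dTwist, ← resRight_dTwist, hU, hV, resLeft_resForm, resRight_resForm,
        sub_self]
    exact ⟨Cohomology.mk _ _ r ⟨_, hσ⟩, hδ _ _ ⟨a, b, rfl, hU.symm, hV.symm⟩⟩
  · rintro ⟨c, rfl⟩
    obtain ⟨σ, rfl⟩ := Cohomology.exists_mk_eq c
    obtain ⟨a, b, hab⟩ := hs r σ
    obtain ⟨η, hU, hV⟩ := exists_isConnecting_of_difference (f := f) (θ := θ) hUV a b
      (by rw [hab]; exact σ.2)
    have hc : IsConnecting f θ U V (σ : DiffForm E ↥(U ⊓ V) r) η := ⟨a, b, hab, hU, hV⟩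
    rw [hδ σ ⟨η, hc.mem_closedForms hθ hUV⟩ hc, alphaStar_mk_eq_zero]
    exact ⟨⟨a, hU.symm⟩, ⟨b, hV.symm⟩⟩

end Exactness
end LichCoh

namespace LichCoh

open TopologicalSpace (Opens)

/-! ### The partition of unity and the explicit formula for `δ` -/

section PartitionOfUnity

variable {E : Type*} [NormedAddCommGroup E] [NormedSpace ℝ E]
  {M : Type*} [TopologicalSpace M] [ChartedSpace E M] [IsManifold 𝓘(ℝ, E) ∞ M] {r : ℕ}
  {U V : Opens M} {ρ : SmoothPartitionOfUnity (Fin 2) 𝓘(ℝ, E) M Set.univ}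

theorem partition_add_eq_one (ρ : SmoothPartitionOfUnity (Fin 2) 𝓘(ℝ, E) M Set.univ) (x : M) :
    ρ 0 x + ρ 1 x = 1 := by
  have h := ρ.sum_eq_one (Set.mem_univ x)
  rwa [finsum_eq_sum_of_fintype, Fin.sum_univ_two] at h

/-- Here `ρ 0` is `λ_U` and `ρ 1` is `λ_V`. The form `a` is `λ_V σ` on the overlap, which extends by
zero to `U` because the support of `λ_V` lies in `V`; symmetrically, `b` extends `-λ_U σ`. The
vanishing statements are recorded for `exists_isConnecting_extension`. -/
theorem exists_difference_eq (hρ : ρ.IsSubordinate ![(U : Set M), (V : Set M)])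
    (σ : DiffForm E ↥(U ⊓ V) r) :
    ∃ (a : DiffForm E U r) (b : DiffForm E V r), resLeft U V a - resRight U V b = σ ∧
      resLeft U V a = DiffForm.funSMul (resFun (U ⊓ V) (ρ 1)) σ ∧
      (∀ x : U, x.1 ∉ tsupport (ρ 1) → a x = 0) ∧ ∀ x : V, x.1 ∉ tsupport (ρ 0) → b x = 0 := by
  obtain ⟨a, ha, ha0⟩ := exists_extension_smul (X := U) (W := U ⊓ V) (ρ 1)
    (fun x hx hs => ⟨hx, hρ 1 hs⟩) σ
  obtain ⟨b, hb, hb0⟩ := exists_extension_smul (X := V) (W := U ⊓ V) (ρ 0)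
    (fun x hx hs => ⟨hρ 0 hs, hx⟩) σ
  have hb' : ∀ x : ↥(U ⊓ V), (show E [⋀^Fin r]→L[ℝ] ℝ from resRight U V (-b) x) =
      -(ρ 0 x.1 • (show E [⋀^Fin r]→L[ℝ] ℝ from σ x)) := fun x =>
    (pullback_inclLE_apply _ (-b) x).trans (congrArg Neg.neg (hb (Opens.inclusion inf_le_right x) x.2))
  have ha' : ∀ x : ↥(U ⊓ V), (show E [⋀^Fin r]→L[ℝ] ℝ from resLeft U V a x) =
      ρ 1 x.1 • (show E [⋀^Fin r]→L[ℝ] ℝ from σ x) := fun x =>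
    (pullback_inclLE_apply _ a x).trans (ha (Opens.inclusion inf_le_left x) x.2)
  refine ⟨a, -b, ContMDiffSection.ext fun x => ?_, ContMDiffSection.ext ha', ha0, fun x hx => ?_⟩
  · change (show E [⋀^Fin r]→L[ℝ] ℝ from resLeft U V a x) -
      (show E [⋀^Fin r]→L[ℝ] ℝ from resRight U V (-b) x) = (show E [⋀^Fin r]→L[ℝ] ℝ from σ x)
    rw [ha', hb', sub_neg_eq_add, ← add_smul, add_comm, partition_add_eq_one, one_smul]
  · exact (congrArg Neg.neg (hb0 x hx)).trans neg_zero

/-- Finite dimension, the Hausdorff property and σ-compactness serve only here, to provide a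
subordinate partition of unity. -/
theorem differenceSurjective [FiniteDimensional ℝ E] [T2Space M] [SigmaCompactSpace M] (hUV : U ⊔ V = ⊤) :
    DifferenceSurjective E U V := by
  intro r σ
  obtain ⟨ρ, hρ⟩ := SmoothPartitionOfUnity.exists_isSubordinate 𝓘(ℝ, E) isClosed_univ
    ![(U : Set M), (V : Set M)]
    (by intro i; fin_cases i; exacts [U.2, V.2])
    (by
      intro x _
      rcases (by rw [← Opens.coe_sup, hUV]; trivial : x ∈ (U : Set M) ∪ V) with hx | hx
      · exact Set.mem_iUnion.2 ⟨0, hx⟩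
      · exact Set.mem_iUnion.2 ⟨1, hx⟩)
  obtain ⟨a, b, h, -⟩ := exists_difference_eq hρ σ
  exact ⟨a, b, h⟩

/-- The two functions sum to `1`, and `d_f 1 = f d1 = 0`. -/
theorem dFun_partition (f : C^∞⟮𝓘(ℝ, E), M; ℝ⟯)
    (ρ : SmoothPartitionOfUnity (Fin 2) 𝓘(ℝ, E) M Set.univ) :
    DiffForm.dFun f 0 (DiffForm.ofFun (ρ 0)) = -DiffForm.dFun f 0 (DiffForm.ofFun (ρ 1)) := by
  have h : (DiffForm.ofFun (ρ 0) + DiffForm.ofFun (ρ 1) : DiffForm E M 0) = DiffForm.ofFun 1 := by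
    refine ContMDiffSection.ext fun x => ?_
    change ContinuousAlternatingMap.constOfIsEmpty ℝ E (Fin 0) (ρ 0 x) +
      ContinuousAlternatingMap.constOfIsEmpty ℝ E (Fin 0) (ρ 1 x) =
      ContinuousAlternatingMap.constOfIsEmpty ℝ E (Fin 0) 1
    ext v
    exact partition_add_eq_one ρ x
  rw [eq_neg_iff_add_eq_zero, ← map_add, h, DiffForm.dFun_zero_ofFun, d_ofFun_one, map_zero]

variable {f : C^∞⟮𝓘(ℝ, E), M; ℝ⟯} {θ : DiffForm E M 1}

theorem exists_isConnecting_extension (hUV : U ⊔ V = ⊤)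
    (hρ : ρ.IsSubordinate ![(U : Set M), (V : Set M)])
    (σ : closedForms (resFun (U ⊓ V) f) (resForm (U ⊓ V) θ) r) :
    ∃ η : DiffForm E M (r + 1),
      IsConnecting f θ U V (σ : DiffForm E ↥(U ⊓ V) r) η ∧
      IsExtensionByZero
        (DiffForm.wedge (resForm (U ⊓ V) (DiffForm.dFun f 0 (DiffForm.ofFun (ρ 1))))
          (σ : DiffForm E ↥(U ⊓ V) r)) η := by
  obtain ⟨a, b, hab, ha, ha0, hb0⟩ := exists_difference_eq hρ (σ : DiffForm E ↥(U ⊓ V) r)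
  obtain ⟨η, hU, hV⟩ := exists_isConnecting_of_difference (f := f) (θ := θ) hUV a b
    (by rw [hab]; exact σ.2)
  refine ⟨η, ⟨a, b, hab, hU, hV⟩, ?_, fun x hx => ?_⟩
  · have hσ : DiffForm.dTwist (resFun (U ⊓ V) f) (resForm (U ⊓ V) θ) r
        (σ : DiffForm E ↥(U ⊓ V) r) = 0 := σ.2
    have hd : resForm (U ⊓ V) (DiffForm.dFun f 0 (DiffForm.ofFun (ρ 1))) =
        DiffForm.dFun (resFun (U ⊓ V) f) 0 (DiffForm.ofFun (resFun (U ⊓ V) (ρ 1))) := by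
      rw [resForm, DiffForm.pullback_dFun, DiffForm.pullback_ofFun]
      rfl
    -- On the overlap `η = d_{f,θ}(λ_V σ)`; the Leibniz rule leaves only `d_f λ_V ∧ σ`, since `σ` is
    -- closed.
    rw [← resLeft_resForm, hU, resLeft_dTwist, ha, DiffForm.dTwist_funSMul, hσ, map_zero, add_zero,
      hd]
  -- A point of `U` outside `U ∩ V` avoids the support of `λ_V`, so `a` vanishes around it and, by
  -- locality, so does `η = d_{f,θ} a`. Points of `V` are treated likewise with `b` and `λ_U`.
  · rcases (by rw [← Opens.coe_sup, hUV]; trivial : x ∈ (U : Set M) ∪ V) with h | h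
    · have hT : x ∉ tsupport (ρ 1) := fun hs => hx ⟨h, hρ 1 hs⟩
      have e := dTwist_apply_eq_zero (T := ⟨(tsupport (ρ 1))ᶜ, (isClosed_tsupport _).isOpen_compl⟩)
        f θ a (fun y hy => ha0 y hy) ⟨x, h⟩ hT
      rw [← hU, resForm_apply] at e
      exact e
    · have hT : x ∉ tsupport (ρ 0) := fun hs => hx ⟨hρ 0 hs, h⟩
      have e := dTwist_apply_eq_zero (T := ⟨(tsupport (ρ 0))ᶜ, (isClosed_tsupport _).isOpen_compl⟩)
        f θ b (fun y hy => hb0 y hy) ⟨x, h⟩ hT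
      rw [← hV, resForm_apply] at e
      exact e

theorem IsExtensionByZero.neg {W : Opens M} {τ : DiffForm E W r} {η : DiffForm E M r}
    (h : IsExtensionByZero τ η) : IsExtensionByZero (-τ) (-η) :=
  ⟨by rw [map_neg, h.1], fun x hx => (congrArg Neg.neg (h.2 x hx)).trans neg_zero⟩

end PartitionOfUnity

end LichCoh

theorem theorem2p1
    {E : Type*} [NormedAddCommGroup E] [NormedSpace ℝ E] [FiniteDimensional ℝ E]
    {M : Type*} [TopologicalSpace M] [T2Space M] [SigmaCompactSpace M]
    [ChartedSpace E M] [IsManifold 𝓘(ℝ, E) ∞ M]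
    (f : C^∞⟮𝓘(ℝ, E), M; ℝ⟯) (θ : DiffForm E M 1) (hθ : DiffForm.d 1 θ = 0)
    (U V : TopologicalSpace.Opens M) (hUV : U ⊔ V = ⊤) :
    ∃ δ : ∀ r : ℕ, Cohomology (resFun (U ⊓ V) f) (resForm (U ⊓ V) θ) r →ₗ[ℝ]
        Cohomology f θ (r + 1),
      Function.Injective (alphaStar f θ U V 0) ∧
      (∀ r : ℕ,
        Function.Exact (alphaStar f θ U V r) (betaStar f θ U V r) ∧
        Function.Exact (betaStar f θ U V r) (δ r) ∧
        Function.Exact (δ r) (alphaStar f θ U V (r + 1))) ∧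
      ∀ ρ : SmoothPartitionOfUnity (Fin 2) 𝓘(ℝ, E) M Set.univ,
        ρ.IsSubordinate ![(U : Set M), (V : Set M)] →
        ∀ (r : ℕ) (σ : closedForms (resFun (U ⊓ V) f) (resForm (U ⊓ V) θ) r),
          (∃ η : closedForms f θ (r + 1),
            IsExtensionByZero
              (DiffForm.wedge (resForm (U ⊓ V) (DiffForm.dFun f 0 (DiffForm.ofFun (ρ 1))))
                (σ : DiffForm E ↥(U ⊓ V) r))
              (η : DiffForm E M (r + 1)) ∧
            δ r (Cohomology.mk _ _ r σ) = Cohomology.mk f θ (r + 1) η) ∧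
          (∃ η : closedForms f θ (r + 1),
            IsExtensionByZero
              (DiffForm.wedge (resForm (U ⊓ V) (DiffForm.dFun f 0 (DiffForm.ofFun (ρ 0))))
                (σ : DiffForm E ↥(U ⊓ V) r))
              (η : DiffForm E M (r + 1)) ∧
            δ r (Cohomology.mk _ _ r σ) = -Cohomology.mk f θ (r + 1) η) := by
  have hs : DifferenceSurjective E U V := differenceSurjective hUV
  -- The map `δ` is characterized by the zigzag relation alone and fixed before any `ρ`, so the
  -- formulas below hold for every partition of unity at once.
  choose δ hδ using fun r : ℕ => exists_connectingHom (f := f) hθ hUV hs r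
  refine ⟨δ, alphaStar_injective hUV, fun r => ⟨exact_alphaStar_betaStar hθ hUV hs r,
    exact_betaStar_connecting hθ hUV hs (hδ r), exact_connecting_alphaStar hθ hUV hs (hδ r)⟩,
    fun ρ hρ r σ => ?_⟩
  obtain ⟨η, hη, hext⟩ := exists_isConnecting_extension hUV hρ σ
  have hc := hη.mem_closedForms hθ hUV
  have h1 := hδ r σ ⟨η, hc⟩ hη
  -- Since `d_f λ_U = -d_f λ_V`, the extension of `d_f λ_U ∧ σ` is `-η`.
  refine ⟨⟨⟨η, hc⟩, hext, h1⟩, ⟨-⟨η, hc⟩, ?_, ?_⟩⟩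
  · rw [dFun_partition, map_neg, DiffForm.wedge_neg_left]
    exact hext.neg
  · rw [h1, map_neg, neg_neg]
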